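/- Let $M$ be the closed orientable Seifert fibered space with Seifert index $\{b,(o,g);(\alpha_1,\beta_1),\dots,(\alpha_m,\beta_m)\}$, where $b\in\mathbb Z$, $g,m\ge 0$, $\alpha_j\ge 2$ and $\gcd(\alpha_j,\beta_j)=1$. That is, $M$ is obtained from $\Sigma_*\times S^1$, where $\Sigma_*$ is the compact orientable surface of genus $g$ with boundary circles $q_0,\dots,q_m$, by gluing in solid tori $S_0,\dots,S_m$ whose meridians are $q_0-b\,h$ and $\alpha_jq_j+\beta_jh$ ($1\le j\le m$), where $h$ is the regular fiber; here the generators $a_i,b_i,q_1,\dots,q_m$ of $\pi_1(\Sigma_*)$ are chosen so that $q_0=q_1\cdots q_m[a_1,b_1]\cdots[a_g,b_g]$. Let $\ell_j\in\pi_1(M)$ be the homotopy class (defined up to conjugation) of the core of $S_j$. Let $\rho:\pi_1(M)\to \mathrm{SL}_2(\mathbb C)$ be a homomorphism with $\rho(h)=-I$. For $n\ge1$ let $\rho_n=\sigma_n\circ\rho$, where $\sigma_n$ is the $n$-dimensional representation of $\mathrm{SL}_2(\mathbb C)$ on the space $V_n$ of homogeneous polynomials of degree $n-1$ in two variables, $(A\cdot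 p)(z)=p(A^{-1}z)$. Let $\mathrm{Tor}(M;\rho_n)\in\mathbb C^{*}$ denote the Reidemeister torsion, determined up to sign, of the twisted cellular chain complex $V_n\otimes_{\mathbb Z[\pi_1(M)]}C_*(\widetilde M;\mathbb Z)$ (with $v\otimes\gamma c=\rho_n(\gamma)^{-1}v\otimes c$) when this complex is acyclic, with the convention $$\mathrm{Tor}(C_*,\mathbf c)=\prod_{i\ge0}\bigl[\partial_{i+1}(\tilde{\mathbf b}^{i+1})\cup\tilde{\mathbf b}^i/\mathbf c^i\bigr]^{(-1)^{i+1}}.$$ Then $\rho_{2N}$ is acyclic for every $N\ge1$; for $1\le j\le m$ the order of $\rho(\ell_j)$ is finite and even, say $2\lambda_j$; and $$\lim_{N\to\infty}\frac{\log|\mathrm{Tor}(M;\rho_{2N})|}{(2N)^2}=0,\qquad \lim_{N\to\infty}\frac{\log|\mathrm{Tor}(M;\rho_{2N})|}{2N}=-\Bigl(2-2g-\sum_{j=1}^m\frac{\lambda_j-1}{\lambda_j}\Bigr)\log 2 .$$ In particular, if $\lambda_j=\alpha_j$ for all $j$, then $$\lim_{N\to\infty}\frac{\log|\mathrm{Tor}(M;\rho_{2N})|}{2N}=-\Bigl(2-2g-\sum_{j=1}^m\frac{\alpha_j-1}{\alpha_j}\Bigr)\log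 2=-\chi\log2,$$ where $\chi=2-2g-\sum_{j=1}^m\bigl(1-\tfrac1{\alpha_j}\bigr)$ is the Euler characteristic of the base orbifold. -/

import Mathlib

open scoped unitInterval MatrixGroups

namespace SeifertTorsion

noncomputable section

/-! ### Torsion of based acyclic chain complexes -/

section Torsion

variable {F : Type*} [Field F] (C : ℕ → Type*) [∀ i, AddCommGroup (C i)] [∀ i, Module F (C i)]

/-- The chain complex `⋯ → C 2 → C 1 → C 0 → 0`, whose boundary operator
`C (i + 1) → C i` is `d i`, has trivial homology in every degree. -/
def IsAcyclic (d : ∀ i, C (i + 1) →ₗ[F] C i) : Prop :=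
  LinearMap.range (d 0) = ⊤ ∧ ∀ i, LinearMap.ker (d i) = LinearMap.range (d (i + 1))

/-- `τ` is a value of the torsion of the acyclic complex `0 → C n → ⋯ → C 0 → 0` based by `c`.
For every `i` one chooses vectors `b i` in `C i` that the boundary operator maps to a basis of the
space of boundaries in degree `i - 1` (none for `i = 0`).  Then the boundaries of `b (i + 1)`
together with `b i` are a new basis of `C i`, and
`τ = ∏ i, [∂ b (i + 1) ∪ b i / c i] ^ ((-1) ^ (i + 1))`.
The bijections `e i` only fix the order of the vectors of the new basis relative to that of `c i`,
so `τ` is determined up to sign. -/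
def IsTorsion (d : ∀ i, C (i + 1) →ₗ[F] C i) {ι : ℕ → Type*} [∀ i, Fintype (ι i)]
    [∀ i, DecidableEq (ι i)] (c : ∀ i, Module.Basis (ι i) F (C i)) (n : ℕ) (τ : F) : Prop :=
  IsAcyclic C d ∧
  ∃ (r : ℕ → ℕ) (b : ∀ i, Fin (r i) → C i) (e : ∀ i, ι i ≃ Fin (r (i + 1)) ⊕ Fin (r i)),
    r 0 = 0 ∧
    (∀ i, LinearIndependent F (fun k => d i (b (i + 1) k)) ∧
      Submodule.span F (Set.range fun k => d i (b (i + 1) k)) = LinearMap.range (d i)) ∧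
    τ = ∏ i ∈ Finset.range (n + 1),
      (c i).det (fun x => Sum.elim (fun k => d i (b (i + 1) k)) (b i) (e i x)) ^ ((-1 : ℤ) ^ (i + 1))

end Torsion

/-! ### Cellular chain complexes of universal covers, and their twisted versions -/

/-- The cellular chain complex of the universal cover of a finite connected CW complex with
fundamental group `G`: the chain module in degree `i` is the free left `ℤ[G]`-module on the
`i`-cells (one lift being chosen for each cell), and
`∂ (lift of c) = ∑ c', bdry i c c' • (lift of c')`. -/
structure CoverComplex (G : Type) [Group G] where
  dim : ℕ
  cell : ℕ → Type
  fintypeCell : ∀ i, Fintype (cell i)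
  decEqCell : ∀ i, DecidableEq (cell i)
  isEmpty_cell : ∀ i, dim < i → IsEmpty (cell i)
  bdry : ∀ i, cell (i + 1) → cell i → MonoidAlgebra ℤ G

attribute [instance] CoverComplex.fintypeCell CoverComplex.decEqCell

section Twisted

variable {G : Type} [Group G] {V : Type} [AddCommGroup V] [Module ℂ V]

/-- The right action of `ℤ[G]` on `V` in which `γ : G` acts by `ρ(γ)⁻¹`. -/
def rightAction (ρ : Representation ℂ G V) (a : MonoidAlgebra ℤ G) : V →ₗ[ℂ] V :=
  a.coeff.sum fun γ k => k • ρ γ⁻¹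

/-- The chain module `V ⊗_{ℤ[G]} C_i`; the function `f` stands for `∑ c, f c ⊗ c`. -/
abbrev CoverComplex.TwistedChain (K : CoverComplex G) (V : Type) (i : ℕ) : Type :=
  K.cell i → V

/-- The boundary operator of `V ⊗_{ℤ[G]} C_*`, where `v ⊗ γ c = ρ(γ)⁻¹ v ⊗ c`. -/
def CoverComplex.twistedBoundary (K : CoverComplex G) (ρ : Representation ℂ G V) (i : ℕ) :
    K.TwistedChain V (i + 1) →ₗ[ℂ] K.TwistedChain V i :=
  LinearMap.pi fun c' => ∑ c, rightAction ρ (K.bdry i c c') ∘ₗ LinearMap.proj c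

/-- The representation `ρ` is acyclic: the twisted homology vanishes. -/
def CoverComplex.IsAcyclicRep (K : CoverComplex G) (ρ : Representation ℂ G V) : Prop :=
  IsAcyclic (K.TwistedChain V) (K.twistedBoundary ρ)

/-- `τ` is a value of the Reidemeister torsion for the acyclic representation `ρ`: the torsion of
the twisted chain complex based by the vectors `B k ⊗ c`, with `B` a basis of `V`. -/
def CoverComplex.IsReidemeisterTorsion (K : CoverComplex G) (ρ : Representation ℂ G V) (τ : ℂ) :
    Prop :=
  ∃ B : Module.Basis (Fin (Module.finrank ℂ V)) ℂ V,
    IsTorsion (K.TwistedChain V) (K.twistedBoundary ρ)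
      (fun i => Pi.basis fun _ : K.cell i => B) K.dim τ

end Twisted

/-! ### The irreducible representations of `SL(2, ℂ)` -/

/-- Homogeneous polynomials of degree `n - 1` in two variables (for `n ≥ 1`). -/
abbrev BinaryForms (n : ℕ) : Type := MvPolynomial.homogeneousSubmodule (Fin 2) ℂ (n - 1)

/-- The substitution `p(z) ↦ p(A z)`. -/
def substitute (A : Matrix (Fin 2) (Fin 2) ℂ) :
    MvPolynomial (Fin 2) ℂ →ₐ[ℂ] MvPolynomial (Fin 2) ℂ :=
  MvPolynomial.aeval fun i => ∑ k, MvPolynomial.C (A i k) * MvPolynomial.X k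

theorem substitute_X (A : Matrix (Fin 2) (Fin 2) ℂ) (i : Fin 2) :
    substitute A (MvPolynomial.X i) = ∑ k, MvPolynomial.C (A i k) * MvPolynomial.X k :=
  MvPolynomial.aeval_X _ i

theorem substitute_C (A : Matrix (Fin 2) (Fin 2) ℂ) (a : ℂ) :
    substitute A (MvPolynomial.C a) = MvPolynomial.C a :=
  MvPolynomial.aeval_C _ a

theorem substitute_mul (A B : Matrix (Fin 2) (Fin 2) ℂ) (p : MvPolynomial (Fin 2) ℂ) :
    substitute (A * B) p = substitute B (substitute A p) := by
  have h : substitute (A * B) = (substitute B).comp (substitute A) := by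
    refine MvPolynomial.algHom_ext fun i => ?_
    simp only [AlgHom.comp_apply, substitute_X, substitute_C, Matrix.mul_apply, Fin.sum_univ_two,
      map_add, map_mul]
    ring
  rw [h, AlgHom.comp_apply]

theorem substitute_one (p : MvPolynomial (Fin 2) ℂ) : substitute 1 p = p := by
  have h : substitute 1 = AlgHom.id ℂ _ := by
    refine MvPolynomial.algHom_ext fun i => ?_
    fin_cases i <;> simp [substitute_X, Fin.sum_univ_two]
  rw [h, AlgHom.id_apply]

theorem substitute_mem (A : Matrix (Fin 2) (Fin 2) ℂ) (k : ℕ) (p : MvPolynomial (Fin 2) ℂ)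
    (hp : p ∈ MvPolynomial.homogeneousSubmodule (Fin 2) ℂ k) :
    substitute A p ∈ MvPolynomial.homogeneousSubmodule (Fin 2) ℂ k := by
  have h : (substitute A p).IsHomogeneous (1 * k) := by
    refine MvPolynomial.IsHomogeneous.aeval
      ((MvPolynomial.mem_homogeneousSubmodule k p).1 hp) _ fun i => ?_
    refine MvPolynomial.IsHomogeneous.sum _ _ _ fun l _ => ?_
    exact MvPolynomial.isHomogeneous_C_mul_X (A i l) l
  rw [one_mul] at h
  exact (MvPolynomial.mem_homogeneousSubmodule k _).2 h

/-- The action of `A` on homogeneous polynomials: `(A · p)(z) = p(A⁻¹ z)`. -/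
def symAct (n : ℕ) (A : SL(2, ℂ)) : BinaryForms n →ₗ[ℂ] BinaryForms n where
  toFun p := ⟨substitute (A⁻¹).1 p.1, substitute_mem (A⁻¹).1 (n - 1) p.1 p.2⟩
  map_add' p q := Subtype.ext (map_add (substitute (A⁻¹).1) p.1 q.1)
  map_smul' a p := Subtype.ext (map_smul (substitute (A⁻¹).1) a p.1)

theorem symAct_one (n : ℕ) : symAct n 1 = 1 := by
  refine LinearMap.ext fun p => Subtype.ext ?_
  have h : ((1 : SL(2, ℂ))⁻¹).1 = 1 := by rw [inv_one]; rfl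
  exact (congrArg (fun M => substitute M p.1) h).trans (substitute_one p.1)

theorem symAct_mul (n : ℕ) (A B : SL(2, ℂ)) : symAct n (A * B) = symAct n A * symAct n B := by
  refine LinearMap.ext fun p => Subtype.ext ?_
  have h : ((A * B)⁻¹).1 = (B⁻¹).1 * (A⁻¹).1 := by rw [mul_inv_rev]; rfl
  exact (congrArg (fun M => substitute M p.1) h).trans (substitute_mul _ _ p.1)

/-- The representation `σ_n` of `SL(2, ℂ)`, of dimension `n` (for `n ≥ 1`). -/
def symRep (n : ℕ) : Representation ℂ SL(2, ℂ) (BinaryForms n) where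
  toFun := symAct n
  map_one' := symAct_one n
  map_mul' := symAct_mul n

/-! ### Fundamental groups -/

/-- The fundamental group of `X` at `x`, in which the product `p * q` is "first `p`, then `q`"
(in Mathlib's `FundamentalGroup` it is "first `q`, then `p`"). -/
abbrev PiOne (X : Type) [TopologicalSpace X] (x : X) : Type := (FundamentalGroup X x)ᵐᵒᵖ

/-- The class of a loop in the fundamental group. -/
def loopClass {X : Type} [TopologicalSpace X] {x : X} (γ : Path x x) : PiOne X x :=
  MulOpposite.op (FundamentalGroup.fromPath (Path.Homotopic.Quotient.mk γ))

/-- The loop running once around the unit circle. -/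
def circleLoop : Path (1 : Circle) 1 where
  toFun s := Circle.exp (2 * Real.pi * s)
  source' := by simp
  target' := by simp

/-! ### Wedges of circles -/

/-- The wedge of circles indexed by `E`, as the union of the coordinate circles of a torus. -/
abbrev Wedge (E : Type) : Type := {f : E → Circle // ∀ e e', f e ≠ 1 → f e' ≠ 1 → e = e'}

/-- The common point of the circles. -/
def Wedge.base (E : Type) : Wedge E := ⟨1, fun _ _ h => absurd rfl h⟩

section Words

variable {E : Type} [DecidableEq E]

/-- The inclusion of the circle with index `e`. -/
def Wedge.petal (e : E) (z : Circle) : Wedge E :=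
  ⟨Pi.mulSingle e z, fun e₁ e₂ h₁ h₂ => by
    have key : ∀ e', (Pi.mulSingle e z : E → Circle) e' ≠ 1 → e' = e := fun e' h => by
      by_contra hne
      exact h (Pi.mulSingle_eq_of_ne (M := fun _ => Circle) hne z)
    rw [key e₁ h₁, key e₂ h₂]⟩

theorem Wedge.continuous_petal (e : E) : Continuous (Wedge.petal e) :=
  Continuous.subtype_mk (continuous_mulSingle (A := fun _ : E => Circle) e) _

theorem Wedge.petal_one (e : E) : Wedge.petal e 1 = Wedge.base E :=
  Subtype.ext (Pi.mulSingle_one e)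

/-- The loop running once around the circle with index `e`. -/
def Wedge.petalLoop (e : E) : Path (Wedge.base E) (Wedge.base E) :=
  (circleLoop.map (Wedge.continuous_petal e)).cast (Wedge.petal_one e).symm
    (Wedge.petal_one e).symm

/-- The loop spelled by a word; `(e, true)` stands for the letter `e` and `(e, false)` for its
inverse. -/
def Wedge.wordLoop : List (E × Bool) → Path (Wedge.base E) (Wedge.base E)
  | [] => Path.refl _
  | (e, true) :: w => (Wedge.petalLoop e).trans (Wedge.wordLoop w)
  | (e, false) :: w => (Wedge.petalLoop e).symm.trans (Wedge.wordLoop w)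

end Words

/-! ### Seifert fibered spaces -/

/-- The Seifert index `{b, (o, g); (α 0, β 0), …, (α (m - 1), β (m - 1))}`. -/
structure SeifertIndex where
  b : ℤ
  g : ℕ
  m : ℕ
  α : Fin m → ℕ
  β : Fin m → ℤ
  two_le : ∀ j, 2 ≤ α j
  coprime : ∀ j, IsCoprime (α j : ℤ) (β j)

/-- Integers `μ j`, `ν j` with `α j * ν j - β j * μ j = -1`.  The gluing of the `j`-th solid torus
`D² × S¹` takes the meridian `∂D² × {*}` to `α q + β h` and the longitude `{*} × S¹` to
`μ q + ν h`. -/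
structure SeifertIndex.Framing (S : SeifertIndex) where
  μ : Fin S.m → ℤ
  ν : Fin S.m → ℤ
  det : ∀ j, (S.α j : ℤ) * ν j - S.β j * μ j = -1

/-- The Euler characteristic of the base orbifold, which is the closed orientable surface of
genus `g` with cone points of orders `α j`. -/
def SeifertIndex.orbifoldEulerChar (S : SeifertIndex) : ℝ :=
  2 - 2 * (S.g : ℝ) - ∑ j, (1 - 1 / (S.α j : ℝ))

/-- The slopes of all `m + 1` solid tori; the one with index `0` has slope `1 / (-b)` and accounts
for the obstruction class `b`. -/
def SeifertIndex.slopeα (S : SeifertIndex) : Fin (S.m + 1) → ℤ := Fin.cons 1 fun j => (S.α j : ℤ)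

def SeifertIndex.slopeβ (S : SeifertIndex) : Fin (S.m + 1) → ℤ := Fin.cons (-S.b) S.β

def SeifertIndex.Framing.slopeμ {S : SeifertIndex} (T : S.Framing) : Fin (S.m + 1) → ℤ :=
  Fin.cons 0 T.μ

def SeifertIndex.Framing.slopeν {S : SeifertIndex} (T : S.Framing) : Fin (S.m + 1) → ℤ :=
  Fin.cons (-1) T.ν

/-- The free generators `a i`, `b i` (`i < g`) and `q j` (`j < m`) of the fundamental group of the
surface of genus `g` with `m + 1` boundary circles. -/
abbrev Gen (g m : ℕ) : Type := (Fin g ⊕ Fin g) ⊕ Fin m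

abbrev Gen.a {g m : ℕ} (i : Fin g) : Gen g m := Sum.inl (Sum.inl i)
abbrev Gen.b {g m : ℕ} (i : Fin g) : Gen g m := Sum.inl (Sum.inr i)
abbrev Gen.q {g m : ℕ} (j : Fin m) : Gen g m := Sum.inr j

/-- The words spelled by the `m + 1` boundary circles: the one with index `0` is
`q 1 ⋯ q m [a 1, b 1] ⋯ [a g, b g]`, and the others are the letters `q j`. -/
def boundaryWord (g m : ℕ) : Fin (m + 1) → List (Gen g m × Bool) :=
  Fin.cons
    ((List.finRange m).map (fun j => (Gen.q j, true)) ++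
      (List.finRange g).flatMap fun i =>
        [(Gen.a i, true), (Gen.b i, true), (Gen.a i, false), (Gen.b i, false)])
    (fun j => [(Gen.q j, true)])

/-- The gluing that defines the surface: the end `u = 0` of the annulus `S¹ × [0, 1]` with index
`j` is attached to the wedge of circles along the `j`-th boundary word. -/
inductive SurfaceRel (g m : ℕ) :
    Wedge (Gen g m) ⊕ (Fin (m + 1) × Circle × I) →
      Wedge (Gen g m) ⊕ (Fin (m + 1) × Circle × I) → Prop
  | glue (j : Fin (m + 1)) (s : I) :
      SurfaceRel g m (Sum.inr (j, circleLoop s, 0))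
        (Sum.inl (Wedge.wordLoop (boundaryWord g m j) s))

/-- The compact orientable surface `Σ_*` of genus `g` with `m + 1` boundary circles, as a ribbon
surface: a wedge of `2 g + m` circles thickened by one annulus for each boundary circle.  (The
boundary words run over every circle of the wedge exactly twice, and capping off the annuli by discs
gives the closed orientable surface of genus `g`.) -/
def Surface (g m : ℕ) : Type := Quot (SurfaceRel g m)

instance (g m : ℕ) : TopologicalSpace (Surface g m) :=
  inferInstanceAs (TopologicalSpace (Quot (SurfaceRel g m)))

/-- The inclusion of the wedge of circles into the surface. -/
def Surface.ofWedge {g m : ℕ} (x : Wedge (Gen g m)) : Surface g m := Quot.mk _ (Sum.inl x)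

/-- The annuli in the surface. -/
def Surface.annulus {g m : ℕ} (j : Fin (m + 1)) (x : Circle) (u : I) : Surface g m :=
  Quot.mk _ (Sum.inr (j, x, u))

theorem Surface.continuous_ofWedge {g m : ℕ} :
    Continuous (Surface.ofWedge : Wedge (Gen g m) → Surface g m) :=
  continuous_quot_mk.comp continuous_inl

theorem Surface.continuous_annulus {g m : ℕ} (j : Fin (m + 1)) :
    Continuous (fun p : Circle × I => (Surface.annulus j p.1 p.2 : Surface g m)) :=
  continuous_quot_mk.comp (continuous_inr.comp (by fun_prop))

theorem Surface.annulus_one_zero {g m : ℕ} (j : Fin (m + 1)) :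
    (Surface.annulus j 1 0 : Surface g m) = Surface.ofWedge (Wedge.base _) := by
  have h := Quot.sound (SurfaceRel.glue (g := g) (m := m) j 0)
  rw [Path.source, Path.source] at h
  exact h

/-- The closed unit disc. -/
abbrev Disc : Type := Metric.closedBall (0 : ℂ) 1

/-- The boundary circle of the disc. -/
def Disc.ofCircle (x : Circle) : Disc := ⟨x, by simp [Circle.norm_coe]⟩

/-- The radial path from the boundary point `1` to the centre of the disc. -/
def Disc.ray (r : I) : Disc :=
  ⟨((1 - r : ℝ) : ℂ), by
    rw [mem_closedBall_zero_iff, Complex.norm_real, Real.norm_eq_abs, abs_le]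
    constructor <;> linarith [r.2.1, r.2.2]⟩

/-- The Dehn filling: on the boundary of the `j`-th solid torus `D² × S¹`, the point `(x, y)` is
glued to the point with coordinates `(x ^ α * y ^ μ, x ^ β * y ^ ν)` on the `j`-th boundary torus
(boundary circle `q j` times fiber `h`) of `Σ_* × S¹`. -/
inductive SpaceRel (S : SeifertIndex) (T : S.Framing) :
    (Surface S.g S.m × Circle) ⊕ (Fin (S.m + 1) × Disc × Circle) →
      (Surface S.g S.m × Circle) ⊕ (Fin (S.m + 1) × Disc × Circle) → Prop
  | glue (j : Fin (S.m + 1)) (x y : Circle) :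
      SpaceRel S T (Sum.inr (j, Disc.ofCircle x, y))
        (Sum.inl (Surface.annulus j (x ^ S.slopeα j * y ^ T.slopeμ j) 1,
          x ^ S.slopeβ j * y ^ T.slopeν j))

/-- The Seifert fibered space with index `S`: the trivial circle bundle `Σ_* × S¹` with `m + 1`
solid tori glued in. -/
def Space (S : SeifertIndex) (T : S.Framing) : Type := Quot (SpaceRel S T)

instance (S : SeifertIndex) (T : S.Framing) : TopologicalSpace (Space S T) :=
  inferInstanceAs (TopologicalSpace (Quot (SpaceRel S T)))

section Loops

variable (S : SeifertIndex) (T : S.Framing)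

/-- The inclusion of the circle bundle. -/
def Space.ofBundle (p : Surface S.g S.m × Circle) : Space S T := Quot.mk _ (Sum.inl p)

/-- The inclusions of the solid tori. -/
def Space.ofSolidTorus (j : Fin (S.m + 1)) (p : Disc × Circle) : Space S T :=
  Quot.mk _ (Sum.inr (j, p))

theorem Space.continuous_ofBundle : Continuous (Space.ofBundle S T) :=
  continuous_quot_mk.comp continuous_inl

theorem Space.continuous_ofSolidTorus (j : Fin (S.m + 1)) :
    Continuous (Space.ofSolidTorus S T j) :=
  continuous_quot_mk.comp (continuous_inr.comp (by fun_prop))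

theorem Space.ofSolidTorus_one (j : Fin (S.m + 1)) :
    Space.ofSolidTorus S T j (Disc.ofCircle 1, 1) =
      Space.ofBundle S T (Surface.annulus j 1 1, 1) := by
  have h := Quot.sound (SpaceRel.glue (S := S) (T := T) j 1 1)
  simp only [one_zpow, mul_one] at h
  exact h

/-- The base point. -/
def Space.base : Space S T := Space.ofBundle S T (Surface.ofWedge (Wedge.base _), 1)

/-- The loop in `Σ_* × {1}` given by a generator of the fundamental group of `Σ_*`. -/
def Space.genLoop (x : Gen S.g S.m) : Path (Space.base S T) (Space.base S T) :=
  (Wedge.petalLoop x).map (f := fun p => Space.ofBundle S T (Surface.ofWedge p, 1))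
    ((Space.continuous_ofBundle S T).comp (Surface.continuous_ofWedge.prodMk continuous_const))

/-- The regular fiber through the base point. -/
def Space.fiberLoop : Path (Space.base S T) (Space.base S T) :=
  circleLoop.map (f := fun t => Space.ofBundle S T (Surface.ofWedge (Wedge.base _), t))
    ((Space.continuous_ofBundle S T).comp (continuous_const.prodMk continuous_id))

/-- The point `(0, 1)` on the core of the `j`-th solid torus. -/
def Space.corePoint (j : Fin (S.m + 1)) : Space S T :=
  Space.ofSolidTorus S T j (Disc.ray 1, 1)

/-- The core `{0} × S¹` of the `j`-th solid torus. -/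
def Space.core (j : Fin (S.m + 1)) : Path (Space.corePoint S T j) (Space.corePoint S T j) :=
  circleLoop.map (f := fun t => Space.ofSolidTorus S T j (Disc.ray 1, t))
    ((Space.continuous_ofSolidTorus S T j).comp (continuous_const.prodMk continuous_id))

/-- The part of the arc from the base point to the `j`-th core inside the `j`-th annulus. -/
def Space.outerArc (j : Fin (S.m + 1)) :
    Path (Space.base S T) (Space.ofBundle S T (Surface.annulus j 1 1, 1)) where
  toFun u := Space.ofBundle S T (Surface.annulus j 1 u, 1)
  continuous_toFun := (Space.continuous_ofBundle S T).comp
    (((Surface.continuous_annulus j).comp (continuous_const.prodMk continuous_id)).prodMk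
      continuous_const)
  source' := by simp only [Surface.annulus_one_zero]; rfl
  target' := rfl

theorem Disc.continuous_ray : Continuous Disc.ray :=
  Continuous.subtype_mk (by fun_prop) _

theorem Disc.ray_zero : Disc.ray 0 = Disc.ofCircle 1 :=
  Subtype.ext (by simp [Disc.ray, Disc.ofCircle])

/-- The part of the arc inside the `j`-th solid torus. -/
def Space.innerArc (j : Fin (S.m + 1)) :
    Path (Space.ofBundle S T (Surface.annulus j 1 1, 1)) (Space.corePoint S T j) where
  toFun r := Space.ofSolidTorus S T j (Disc.ray r, 1)
  continuous_toFun := (Space.continuous_ofSolidTorus S T j).comp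
    (Disc.continuous_ray.prodMk continuous_const)
  source' := by rw [Disc.ray_zero, Space.ofSolidTorus_one]
  target' := rfl

/-- The arc from the base point to the core of the `j`-th solid torus. -/
def Space.arc (j : Fin (S.m + 1)) : Path (Space.base S T) (Space.corePoint S T j) :=
  (Space.outerArc S T j).trans (Space.innerArc S T j)

/-- The homotopy class `ℓ j` of the core of the `j`-th solid torus. -/
def Space.coreClass (j : Fin (S.m + 1)) : PiOne (Space S T) (Space.base S T) :=
  loopClass (((Space.arc S T j).trans (Space.core S T j)).trans (Space.arc S T j).symm)

/-- The homotopy class `h` of the regular fiber. -/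
def Space.fiberClass : PiOne (Space S T) (Space.base S T) := loopClass (Space.fiberLoop S T)

end Loops

/-! ### The cellular chain complex of the Seifert fibered space

The cell decomposition consists of the product cells of `(wedge of circles) × S¹`, and, for each
solid torus, of the core, with its product structure `point ∪ edge`, and the cells swept out by the
cells `point`, `q`, `h`, `q × h` of the boundary torus along the segments of the annulus and the
radii of the disc, from the wedge to the core. -/

/-- The vertices: the base point and a point on each core. -/
abbrev Cell0 (m : ℕ) : Type := Unit ⊕ Fin (m + 1)

abbrev Cell0.base {m : ℕ} : Cell0 m := Sum.inl ()
abbrev Cell0.corePoint {m : ℕ} (j : Fin (m + 1)) : Cell0 m := Sum.inr j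

/-- The edges: the circles of the wedge, the fiber, the cores and the arcs. -/
abbrev Cell1 (g m : ℕ) : Type := (Gen g m ⊕ Unit) ⊕ (Fin (m + 1) ⊕ Fin (m + 1))

abbrev Cell1.gen {g m : ℕ} (x : Gen g m) : Cell1 g m := Sum.inl (Sum.inl x)
abbrev Cell1.fiber {g m : ℕ} : Cell1 g m := Sum.inl (Sum.inr ())
abbrev Cell1.core {g m : ℕ} (j : Fin (m + 1)) : Cell1 g m := Sum.inr (Sum.inl j)
abbrev Cell1.arc {g m : ℕ} (j : Fin (m + 1)) : Cell1 g m := Sum.inr (Sum.inr j)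

/-- The 2-cells: the products (circle of the wedge) × fiber, and the 2-cells swept out by `q j` and
by the fiber. -/
abbrev Cell2 (g m : ℕ) : Type := Gen g m ⊕ (Fin (m + 1) ⊕ Fin (m + 1))

abbrev Cell2.torus {g m : ℕ} (x : Gen g m) : Cell2 g m := Sum.inl x
abbrev Cell2.qSweep {g m : ℕ} (j : Fin (m + 1)) : Cell2 g m := Sum.inr (Sum.inl j)
abbrev Cell2.hSweep {g m : ℕ} (j : Fin (m + 1)) : Cell2 g m := Sum.inr (Sum.inr j)

/-- The 3-cells, swept out by the 2-cells of the boundary tori. -/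
abbrev Cell3 (m : ℕ) : Type := Fin (m + 1)

/-- The initial vertex of an edge. -/
def edgeSource {g m : ℕ} : Cell1 g m → Cell0 m
  | .inl _ => Cell0.base
  | .inr (.inl j) => Cell0.corePoint j
  | .inr (.inr _) => Cell0.base

/-- The terminal vertex of an edge. -/
def edgeTarget {g m : ℕ} : Cell1 g m → Cell0 m
  | .inl _ => Cell0.base
  | .inr (.inl j) => Cell0.corePoint j
  | .inr (.inr j) => Cell0.corePoint j

/-- The edge path `e ^ k` for a closed edge `e`. -/
def edgePow {g m : ℕ} (e : Cell1 g m) (k : ℤ) : List (Cell1 g m × Bool) :=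
  List.replicate k.natAbs (e, decide (0 ≤ k))

/-- The `j`-th boundary word as an edge path. -/
def boundaryEdgePath (g m : ℕ) (j : Fin (m + 1)) : List (Cell1 g m × Bool) :=
  (boundaryWord g m j).map fun x => (Cell1.gen x.1, x.2)

/-- The attaching edge paths of the 2-cells.  On the `j`-th boundary torus `q` and `h` have the
coordinates `(-ν, β)` and `(μ, -α)` in terms of the meridian and the longitude of the solid torus,
so that the radial projection to the core takes `q` to `core ^ β` and `h` to `core ^ (-α)`. -/
def attachingPath (S : SeifertIndex) : Cell2 S.g S.m → List (Cell1 S.g S.m × Bool)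
  | .inl x =>
      [(Cell1.gen x, true), (Cell1.fiber, true), (Cell1.gen x, false), (Cell1.fiber, false)]
  | .inr (.inl j) =>
      boundaryEdgePath S.g S.m j ++ [(Cell1.arc j, true)] ++
        edgePow (Cell1.core j) (-S.slopeβ j) ++ [(Cell1.arc j, false)]
  | .inr (.inr j) =>
      [(Cell1.fiber, true), (Cell1.arc j, true)] ++
        edgePow (Cell1.core j) (S.slopeα j) ++ [(Cell1.arc j, false)]

section FoxCalculus

variable {G : Type} [Group G] {E : Type} [DecidableEq E] (hol : E → G)

/-- The element of `G` determined by an edge path. -/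
def pathHol : List (E × Bool) → G
  | [] => 1
  | (e, true) :: w => hol e * pathHol w
  | (e, false) :: w => (hol e)⁻¹ * pathHol w

/-- Fox calculus: the coefficient, at the lift of the edge `c`, of the 1-chain of the universal
cover given by the lift of an edge path. -/
def foxDeriv : List (E × Bool) → E → MonoidAlgebra ℤ G
  | [], _ => 0
  | (e, true) :: w, c => (if e = c then 1 else 0) + MonoidAlgebra.single (hol e) 1 * foxDeriv w c
  | (e, false) :: w, c =>
      MonoidAlgebra.single (hol e)⁻¹ 1 * (foxDeriv w c - if e = c then 1 else 0)

end FoxCalculus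

section Complex

variable (S : SeifertIndex) {G : Type} [Group G] (hol : Cell1 S.g S.m → G)

/-- An edge `e` is lifted so as to start at the chosen lift of its initial vertex; it ends at
`hol e` times the chosen lift of its terminal vertex. -/
def boundary₁ (e : Cell1 S.g S.m) (v : Cell0 S.m) : MonoidAlgebra ℤ G :=
  (if edgeTarget e = v then MonoidAlgebra.single (hol e) 1 else 0) -
    (if edgeSource e = v then 1 else 0)

/-- The boundary of a 2-cell is the lift of its attaching edge path. -/
def boundary₂ (f : Cell2 S.g S.m) (e : Cell1 S.g S.m) : MonoidAlgebra ℤ G :=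
  foxDeriv hol (attachingPath S f) e

/-- The boundary of the 3-cell `q × h × (arc)` of the `j`-th solid torus:
`(1 - h) (q × arc) + (q - 1) (h × arc) - (q × h)`, where `q` is spelled by the boundary word in the
wedge of circles.  (The face on the core is degenerate.) -/
def boundary₃ (j : Cell3 S.m) : Cell2 S.g S.m → MonoidAlgebra ℤ G
  | .inl x => -foxDeriv hol (boundaryEdgePath S.g S.m j) (Cell1.gen x)
  | .inr (.inl k) =>
      if j = k then 1 - MonoidAlgebra.single (hol Cell1.fiber) 1 else 0
  | .inr (.inr k) =>
      if j = k then MonoidAlgebra.single (pathHol hol (boundaryEdgePath S.g S.m j)) 1 - 1 else 0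

/-- The complex in which `hol e` is the element of the fundamental group given by the edge `e`. -/
def cellComplex : CoverComplex G where
  dim := 3
  cell
    | 0 => Cell0 S.m
    | 1 => Cell1 S.g S.m
    | 2 => Cell2 S.g S.m
    | 3 => Cell3 S.m
    | _ + 4 => Empty
  fintypeCell
    | 0 => inferInstanceAs (Fintype (Cell0 S.m))
    | 1 => inferInstanceAs (Fintype (Cell1 S.g S.m))
    | 2 => inferInstanceAs (Fintype (Cell2 S.g S.m))
    | 3 => inferInstanceAs (Fintype (Cell3 S.m))
    | _ + 4 => inferInstanceAs (Fintype Empty)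
  decEqCell
    | 0 => inferInstanceAs (DecidableEq (Cell0 S.m))
    | 1 => inferInstanceAs (DecidableEq (Cell1 S.g S.m))
    | 2 => inferInstanceAs (DecidableEq (Cell2 S.g S.m))
    | 3 => inferInstanceAs (DecidableEq (Cell3 S.m))
    | _ + 4 => inferInstanceAs (DecidableEq Empty)
  isEmpty_cell
    | 0, h => absurd h (by decide)
    | 1, h => absurd h (by decide)
    | 2, h => absurd h (by decide)
    | 3, h => absurd h (by decide)
    | _ + 4, _ => inferInstanceAs (IsEmpty Empty)
  bdry
    | 0 => boundary₁ S hol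
    | 1 => boundary₂ S hol
    | 2 => boundary₃ S hol
    | _ + 3 => fun c => Empty.elim c

end Complex

/-- The elements of the fundamental group given by the edges, the arcs being the maximal tree along
which the vertices are joined to the base point. -/
def Space.edgeClass (S : SeifertIndex) (T : S.Framing) :
    Cell1 S.g S.m → PiOne (Space S T) (Space.base S T)
  | .inl (.inl x) => loopClass (Space.genLoop S T x)
  | .inl (.inr _) => Space.fiberClass S T
  | .inr (.inl j) => Space.coreClass S T j
  | .inr (.inr _) => 1

/-- The cellular chain complex of the universal cover of the Seifert fibered space. -/
def Space.coverComplex (S : SeifertIndex) (T : S.Framing) :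
    CoverComplex (PiOne (Space S T) (Space.base S T)) :=
  cellComplex S (Space.edgeClass S T)

/-- The representation `ρ_n = σ_n ∘ ρ`. -/
def inducedRep {G : Type} [Group G] (ρ : G →* SL(2, ℂ)) (n : ℕ) :
    Representation ℂ G (BinaryForms n) :=
  (symRep n).comp ρ

end

end SeifertTorsion

/-!
Since `ρ(h) = -I`, the fiber acts by `-1` in the even-dimensional representations `ρ_{2N}`. Pair
every cell of the Seifert fibered space that contains the fiber direction, and every core, with a
cell one degree lower. In the twisted complex the block between two paired cells is then `±2`,
except between a core `ℓ_j` and its point, where it is `ρ_{2N}(ℓ_j)⁻¹ - 1`, and the square matrix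
between the upper cells and the cells under them is block diagonal. Hence the complex is acyclic as
soon as these blocks are invertible, and up to sign the torsion is the alternating product of their
determinants.

In the fundamental group `h ℓ_j ^ α_j = 1`, so `ρ(ℓ_j) ^ α_j = -I`, and `ρ(ℓ_j)` has eigenvalues
`z_j ^ (±1)` for a primitive `2 λ_j`-th root of unity `z_j`. The eigenvalues on `V_{2N}` are the odd
powers `z_j ^ (±(2i + 1))` with `i < N`, none of which is `1`. As `∏_{i < λ_j} |z_j ^ (2i + 1) - 1|`
is the value `2` of `X ^ λ_j + 1` at `1`, averaging over periods shows that the `j`-th determinant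
contributes `(log 2) / λ_j` to the growth rate of the logarithm of the torsion.
-/

namespace SeifertTorsion

noncomputable section

section Loops

variable {X : Type} [TopologicalSpace X] {x y z : X}

theorem loopClass_trans (γ δ : Path x x) :
    loopClass (γ.trans δ) = loopClass γ * loopClass δ := rfl

theorem loopClass_eq_iff {γ δ : Path x x} : loopClass γ = loopClass δ ↔ γ.Homotopic δ := by
  rw [loopClass, loopClass, MulOpposite.op_inj]
  exact Path.Homotopic.Quotient.eq

/-- The loop at `x` that runs along the arc `δ`, then around the loop `γ`, then back. -/
def lasso (δ : Path x y) (γ : Path y y) : Path x x :=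
  (δ.trans γ).trans δ.symm

theorem loopClass_lasso_congr (δ : Path x y) {γ γ' : Path y y} (h : γ.Homotopic γ') :
    loopClass (lasso δ γ) = loopClass (lasso δ γ') :=
  loopClass_eq_iff.2 (((Path.Homotopic.refl δ).hcomp h).hcomp (Path.Homotopic.refl _))

theorem loopClass_lasso_trans_left (δ : Path x y) (ε : Path y z) (γ : Path z z) :
    loopClass (lasso (δ.trans ε) γ) = loopClass (lasso δ (lasso ε γ)) := by
  apply congrArg MulOpposite.op
  simp only [lasso, Path.trans_symm, Path.Homotopic.Quotient.mk_trans,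
    Path.Homotopic.Quotient.trans_assoc]

theorem loopClass_lasso_refl (δ : Path x y) : loopClass (lasso δ (Path.refl y)) = 1 := by
  refine congrArg MulOpposite.op (a₂ := Path.Homotopic.Quotient.refl x) ?_
  simp [lasso, Path.Homotopic.Quotient.mk_trans]

theorem loopClass_lasso_trans_right (δ : Path x y) (γ γ' : Path y y) :
    loopClass (lasso δ (γ.trans γ')) = loopClass (lasso δ γ) * loopClass (lasso δ γ') := by
  rw [← loopClass_trans]
  apply congrArg MulOpposite.op
  simp only [lasso, Path.Homotopic.Quotient.mk_trans, Path.Homotopic.Quotient.trans_assoc]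
  rw [← Path.Homotopic.Quotient.trans_assoc (Path.Homotopic.Quotient.mk δ.symm)]
  simp [Path.Homotopic.Quotient.mk_symm]

theorem loopClass_eq_loopClass_lasso_of_freeHomotopy (H : C(I × I, X)) (γ₀ : Path x x)
    (γ₁ : Path y y) (δ : Path x y) (h₀ : ∀ s, H (s, 0) = γ₀ s) (h₁ : ∀ s, H (s, 1) = γ₁ s)
    (hl : ∀ u, H (0, u) = δ u) (hr : ∀ u, H (1, u) = δ u) :
    loopClass γ₀ = loopClass (lasso δ γ₁) := by
  rw [loopClass_eq_iff]
  let bottom : Path ((0, 0) : I × I) (1, 0) :=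
    { toFun := fun s => (s, 0), source' := rfl, target' := rfl }
  let left : Path ((0, 0) : I × I) (0, 1) :=
    { toFun := fun u => (0, u), source' := rfl, target' := rfl }
  let top : Path ((0, 1) : I × I) (1, 1) :=
    { toFun := fun s => (s, 1), source' := rfl, target' := rfl }
  let right : Path ((1, 0) : I × I) (1, 1) :=
    { toFun := fun u => (1, u), source' := rfl, target' := rfl }
  have : ContractibleSpace I := (convex_Icc (0 : ℝ) 1).contractibleSpace ⟨0, by simp⟩
  have boundary_homotopic : bottom.Homotopic ((left.trans top).trans right.symm) :=
    SimplyConnectedSpace.paths_homotopic _ _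
  convert (boundary_homotopic.map H).pathCast (x₂ := x) (x₃ := x) (by simp [h₀]) (by simp [h₀])
    using 1
  · ext s
    exact (h₀ s).symm
  · ext s
    simp only [lasso, Path.trans_apply, Path.cast_coe, Path.map_coe, Function.comp_apply,
      Path.symm_apply]
    split_ifs
    · exact (hl _).symm
    · exact (h₁ _).symm
    · exact (hr _).symm

-- Eckmann–Hilton: `δ.trans ε` is the pointwise product of `δ.trans refl` and `refl.trans ε`.
theorem trans_homotopic_mul {M : Type} [TopologicalSpace M] [MulOneClass M] [ContinuousMul M]
    (δ ε : Path (1 : M) 1) :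
    (δ.trans ε).Homotopic ((δ.mul ε).cast (mul_one 1).symm (mul_one 1).symm) := by
  have padded : ((δ.trans (Path.refl 1)).prod ((Path.refl 1).trans ε)).Homotopic (δ.prod ε) :=
    ⟨Path.Homotopic.prodHomotopy (Path.Homotopy.transRefl δ) (Path.Homotopy.reflTrans ε)⟩
  convert (padded.map ⟨fun p : M × M => p.1 * p.2, continuous_mul⟩).pathCast
    (mul_one 1).symm (mul_one 1).symm using 1
  · ext s
    simp only [Path.cast_coe, Path.map_coe, Function.comp_apply, Path.prod_coe, Path.trans_apply,
      ContinuousMap.coe_mk]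
    split_ifs <;> simp
  · rfl

section ZPow

variable {A : Type} [TopologicalSpace A] [Group A] [IsTopologicalGroup A]

/-- The pointwise power `s ↦ γ s ^ k` of a loop at the identity of a topological group. -/
def loopZPow (γ : Path (1 : A) 1) (k : ℤ) : Path (1 : A) 1 where
  toFun s := γ s ^ k
  source' := by simp
  target' := by simp

theorem loopZPow_apply (γ : Path (1 : A) 1) (k : ℤ) (s : I) : loopZPow γ k s = γ s ^ k := rfl

theorem loopZPow_zero (γ : Path (1 : A) 1) : loopZPow γ 0 = Path.refl 1 := by
  ext s
  simp [loopZPow_apply]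

theorem loopZPow_one (γ : Path (1 : A) 1) : loopZPow γ 1 = γ := by
  ext s
  simp [loopZPow_apply]

theorem loopZPow_add_one_homotopic (γ : Path (1 : A) 1) (k : ℤ) :
    (loopZPow γ (k + 1)).Homotopic ((loopZPow γ k).trans γ) := by
  convert (trans_homotopic_mul (loopZPow γ k) γ).symm using 1
  ext s
  exact zpow_add_one _ _

theorem loopClass_lasso_loopZPow {f : A → X} (hf : Continuous f) (δ : Path x (f 1))
    (γ : Path (1 : A) 1) (k : ℤ) :
    loopClass (lasso δ ((loopZPow γ k).map hf)) = loopClass (lasso δ (γ.map hf)) ^ k := by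
  have add_one (k : ℤ) : loopClass (lasso δ ((loopZPow γ (k + 1)).map hf)) =
      loopClass (lasso δ ((loopZPow γ k).map hf)) * loopClass (lasso δ (γ.map hf)) := by
    rw [← loopClass_lasso_trans_right, ← Path.map_trans]
    exact loopClass_lasso_congr δ ((loopZPow_add_one_homotopic γ k).map ⟨f, hf⟩)
  induction k using Int.induction_on with
  | zero =>
    rw [loopZPow_zero, zpow_zero]
    exact loopClass_lasso_refl δ
  | succ k ih => rw [add_one, ih, zpow_add_one]
  | pred k ih =>
    have h := add_one (-(k : ℤ) - 1)
    rw [sub_add_cancel, ih] at h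
    rw [zpow_sub_one, h, mul_inv_cancel_right]

end ZPow

end Loops

/-- The relations that the elements `hol e` of a group `G` given by the edges `e` must satisfy for
the boundaries of the 2-cells swept out by `q j` and by the fiber to close up: the arcs are
trivial, `h = core ^ (-α)` and `q j = core ^ β`. -/
structure IsFillingHolonomy (S : SeifertIndex) {G : Type} [Group G] (hol : Cell1 S.g S.m → G) :
    Prop where
  arc : ∀ j, hol (Cell1.arc j) = 1
  fiber_mul_core_zpow : ∀ j, hol Cell1.fiber * hol (Cell1.core j) ^ S.slopeα j = 1
  pathHol_boundaryEdgePath : ∀ j,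
    pathHol hol (boundaryEdgePath S.g S.m j) = hol (Cell1.core j) ^ S.slopeβ j

theorem SeifertIndex.Framing.slope_det {S : SeifertIndex} (T : S.Framing) (j : Fin (S.m + 1)) :
    S.slopeα j * T.slopeν j - S.slopeβ j * T.slopeμ j = -1 := by
  induction j using Fin.cases with
  | zero => simp [SeifertIndex.slopeα, SeifertIndex.slopeβ, Framing.slopeμ, Framing.slopeν]
  | succ j => exact T.det j

/-- The point at distance `1 - r` from the centre on the radius to `x`. -/
def Disc.shrink (x : Circle) (r : I) : Disc :=
  ⟨((1 - r : ℝ) : ℂ) * x, by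
    rw [mem_closedBall_zero_iff, norm_mul, Circle.norm_coe, mul_one]
    exact mem_closedBall_zero_iff.1 (Disc.ray r).2⟩

theorem Disc.continuous_shrink : Continuous fun p : Circle × I => Disc.shrink p.1 p.2 :=
  Continuous.subtype_mk (by fun_prop) _

theorem Disc.shrink_zero (x : Circle) : Disc.shrink x 0 = Disc.ofCircle x :=
  Subtype.ext (by simp [Disc.shrink, Disc.ofCircle])

theorem Disc.shrink_one (x : Circle) : Disc.shrink x 1 = Disc.ray 1 :=
  Subtype.ext (by simp [Disc.shrink, Disc.ray])

theorem Disc.shrink_base (r : I) : Disc.shrink 1 r = Disc.ray r :=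
  Subtype.ext (by simp [Disc.shrink, Disc.ray])

section Relations

variable (S : SeifertIndex) (T : S.Framing)

/-- The loop running `k` times around the circle. -/
abbrev circlePow (k : ℤ) : Path (1 : Circle) 1 := loopZPow circleLoop k

theorem Space.ofSolidTorus_ofCircle (j : Fin (S.m + 1)) (x y : Circle) :
    Space.ofSolidTorus S T j (Disc.ofCircle x, y) =
      Space.ofBundle S T (Surface.annulus j (x ^ S.slopeα j * y ^ T.slopeμ j) 1,
        x ^ S.slopeβ j * y ^ T.slopeν j) :=
  Quot.sound (SpaceRel.glue j x y)

/-- The loop in the `j`-th boundary torus with direction `(k, l)`, in terms of the coordinates `q`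
and `h`. -/
def Space.torusLoop (j : Fin (S.m + 1)) (k l : ℤ) :
    Path (Space.ofBundle S T (Surface.annulus j 1 1, 1))
      (Space.ofBundle S T (Surface.annulus j 1 1, 1)) where
  toFun s := Space.ofBundle S T (Surface.annulus j (circlePow k s) 1, circlePow l s)
  continuous_toFun := (Space.continuous_ofBundle S T).comp
    (((Surface.continuous_annulus j).comp ((circlePow k).continuous.prodMk continuous_const)).prodMk
      (circlePow l).continuous)
  source' := by simp
  target' := by simp

/-- The loop running `d` times around the core of the `j`-th solid torus. -/
def Space.corePow (j : Fin (S.m + 1)) (d : ℤ) :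
    Path (Space.corePoint S T j) (Space.corePoint S T j) :=
  (circlePow d).map (f := fun t => Space.ofSolidTorus S T j (Disc.ray 1, t))
    ((Space.continuous_ofSolidTorus S T j).comp (continuous_const.prodMk continuous_id))

theorem Space.loopClass_lasso_corePow (j : Fin (S.m + 1)) (d : ℤ) :
    loopClass (lasso (Space.arc S T j) (Space.corePow S T j d)) = Space.coreClass S T j ^ d :=
  loopClass_lasso_loopZPow (f := fun t => Space.ofSolidTorus S T j (Disc.ray 1, t)) _
    (Space.arc S T j) circleLoop d

theorem Space.loopClass_eq_lasso_torusLoop (j : Fin (S.m + 1)) (k l : ℤ)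
    (γ : Path (Space.base S T) (Space.base S T))
    (hγ : ∀ s, γ s = Space.ofBundle S T (Surface.annulus j (circlePow k s) 0, circlePow l s)) :
    loopClass γ = loopClass (lasso (Space.outerArc S T j) (Space.torusLoop S T j k l)) := by
  let H : C(I × I, Space S T) :=
    ⟨fun p => Space.ofBundle S T (Surface.annulus j (circlePow k p.1) p.2, circlePow l p.1),
      (Space.continuous_ofBundle S T).comp
        (((Surface.continuous_annulus j).comp
          (((circlePow k).continuous.comp continuous_fst).prodMk continuous_snd)).prodMk
            ((circlePow l).continuous.comp continuous_fst))⟩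
  refine loopClass_eq_loopClass_lasso_of_freeHomotopy H _ _ _ (fun s => (hγ s).symm)
    (fun s => rfl) (fun u => ?_) (fun u => ?_)
  · change Space.ofBundle S T (Surface.annulus j (circlePow k 0) u, circlePow l 0) = _
    rw [Path.source, Path.source]
    rfl
  · change Space.ofBundle S T (Surface.annulus j (circlePow k 1) u, circlePow l 1) = _
    rw [Path.target, Path.target]
    rfl

-- The radial contraction of the disc turns `c` times the meridian plus `d` times the longitude
-- into `d` times the core.
theorem Space.loopClass_torusLoop (j : Fin (S.m + 1)) (c d : ℤ) :
    loopClass (Space.torusLoop S T j (S.slopeα j * c + T.slopeμ j * d)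
      (S.slopeβ j * c + T.slopeν j * d)) =
    loopClass (lasso (Space.innerArc S T j) (Space.corePow S T j d)) := by
  let H : C(I × I, Space S T) :=
    ⟨fun p => Space.ofSolidTorus S T j (Disc.shrink (circlePow c p.1) p.2, circlePow d p.1),
      (Space.continuous_ofSolidTorus S T j).comp
        ((Disc.continuous_shrink.comp
          (((circlePow c).continuous.comp continuous_fst).prodMk continuous_snd)).prodMk
            ((circlePow d).continuous.comp continuous_fst))⟩
  refine loopClass_eq_loopClass_lasso_of_freeHomotopy H _ _ _ (fun s => ?_) (fun s => ?_)
    (fun u => ?_) (fun u => ?_)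
  · change Space.ofSolidTorus S T j (Disc.shrink (circlePow c s) 0, circlePow d s) =
      Space.ofBundle S T (Surface.annulus j (circlePow _ s) 1, circlePow _ s)
    rw [Disc.shrink_zero, Space.ofSolidTorus_ofCircle]
    simp only [loopZPow_apply, ← zpow_mul, ← zpow_add, mul_comm]
  · change Space.ofSolidTorus S T j (Disc.shrink (circlePow c s) 1, circlePow d s) =
      Space.ofSolidTorus S T j (Disc.ray 1, circlePow d s)
    rw [Disc.shrink_one]
  · change Space.ofSolidTorus S T j (Disc.shrink (circlePow c 0) u, circlePow d 0) =
      Space.ofSolidTorus S T j (Disc.ray u, 1)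
    rw [Path.source, Path.source, Disc.shrink_base]
  · change Space.ofSolidTorus S T j (Disc.shrink (circlePow c 1) u, circlePow d 1) =
      Space.ofSolidTorus S T j (Disc.ray u, 1)
    rw [Path.target, Path.target, Disc.shrink_base]

theorem Space.loopClass_eq_coreClass_zpow (j : Fin (S.m + 1)) (k l : ℤ)
    (γ : Path (Space.base S T) (Space.base S T))
    (hγ : ∀ s, γ s = Space.ofBundle S T (Surface.annulus j (circlePow k s) 0, circlePow l s)) :
    loopClass γ = Space.coreClass S T j ^ (S.slopeβ j * k - S.slopeα j * l) := by
  -- `(c, d)` are the coordinates of `k q + l h` with respect to the meridian and the longitude.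
  set c := T.slopeμ j * l - T.slopeν j * k
  set d := S.slopeβ j * k - S.slopeα j * l
  have hk : S.slopeα j * c + T.slopeμ j * d = k := by
    linear_combination -k * T.slope_det j
  have hl : S.slopeβ j * c + T.slopeν j * d = l := by
    linear_combination -l * T.slope_det j
  have contract := Space.loopClass_torusLoop S T j c d
  rw [hk, hl] at contract
  calc loopClass γ
      = loopClass (lasso (Space.outerArc S T j) (Space.torusLoop S T j k l)) :=
        Space.loopClass_eq_lasso_torusLoop S T j k l γ hγ
    _ = loopClass (lasso (Space.outerArc S T j)
          (lasso (Space.innerArc S T j) (Space.corePow S T j d))) :=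
        loopClass_lasso_congr _ (loopClass_eq_iff.1 contract)
    _ = loopClass (lasso (Space.arc S T j) (Space.corePow S T j d)) :=
        (loopClass_lasso_trans_left _ _ _).symm
    _ = Space.coreClass S T j ^ d := Space.loopClass_lasso_corePow S T j d

theorem Space.fiberClass_mul_coreClass_zpow (j : Fin (S.m + 1)) :
    Space.fiberClass S T * Space.coreClass S T j ^ S.slopeα j = 1 := by
  have fiber_eq : Space.fiberClass S T = _ :=
    Space.loopClass_eq_coreClass_zpow S T j 0 1 (Space.fiberLoop S T) fun s => by
      rw [circlePow, loopZPow_zero, circlePow, loopZPow_one, Path.refl_apply,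
        Surface.annulus_one_zero]
      rfl
  rw [fiber_eq, ← zpow_add]
  simp

theorem Space.loopClass_wordLoop (w : List (Gen S.g S.m × Bool)) :
    loopClass ((Wedge.wordLoop w).map (f := fun p => Space.ofBundle S T (Surface.ofWedge p, 1))
      ((Space.continuous_ofBundle S T).comp
        (Surface.continuous_ofWedge.prodMk continuous_const))) =
      pathHol (Space.edgeClass S T) (w.map fun x => (Cell1.gen x.1, x.2)) := by
  induction w with
  | nil => rfl
  | cons x w ih =>
    obtain ⟨e, _ | _⟩ := x <;>
    · rw [List.map_cons, pathHol, ← ih, Wedge.wordLoop, Path.map_trans, loopClass_trans]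
      rfl

theorem Space.pathHol_edgeClass_boundaryEdgePath (j : Fin (S.m + 1)) :
    pathHol (Space.edgeClass S T) (boundaryEdgePath S.g S.m j) =
      Space.coreClass S T j ^ S.slopeβ j := by
  rw [boundaryEdgePath, ← Space.loopClass_wordLoop]
  refine (Space.loopClass_eq_coreClass_zpow S T j 1 0 _ fun s => ?_).trans (by simp)
  rw [circlePow, loopZPow_one, circlePow, loopZPow_zero]
  exact congrArg (fun p => Space.ofBundle S T (p, 1))
    (Quot.sound (SurfaceRel.glue (g := S.g) (m := S.m) j s)).symm

theorem Space.isFillingHolonomy_edgeClass : IsFillingHolonomy S (Space.edgeClass S T) where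
  arc _ := rfl
  fiber_mul_core_zpow := Space.fiberClass_mul_coreClass_zpow S T
  pathHol_boundaryEdgePath := Space.pathHol_edgeClass_boundaryEdgePath S T

end Relations

section TorsionChoices

open Module

theorem sq_det_comp_equiv_eq {R M ι κ : Type*} [CommRing R] [AddCommGroup M] [Module R M]
    [Fintype ι] [DecidableEq ι] (c : Basis ι R M) (v : κ → M) (e e' : ι ≃ κ) :
    c.det (v ∘ e') ^ 2 = c.det (v ∘ e) ^ 2 := by
  have sign_sq (p : Equiv.Perm ι) : ((Equiv.Perm.sign p : ℤ) : R) ^ 2 = 1 := by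
    rw [← Int.cast_pow, ← Units.val_pow_eq_pow_val, Int.units_sq, Units.val_one, Int.cast_one]
  have permuted : v ∘ e' = (v ∘ e) ∘ (e'.trans e.symm) := by
    ext x
    simp
  rw [permuted, AlternatingMap.map_perm, Units.smul_def, zsmul_eq_mul, mul_pow, sign_sq, one_mul]

theorem det_sum_smul {R M ι : Type*} [CommRing R] [AddCommGroup M] [Module R M] [Fintype ι]
    [DecidableEq ι] (c : Basis ι R M) (A : Matrix ι ι R) (v : ι → M) :
    c.det (fun x => ∑ y, A y x • v y) = A.det * c.det v := by
  rw [Basis.det_apply, Basis.det_apply, mul_comm, ← Matrix.det_mul]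
  congr 1
  ext i x
  simp [Basis.toMatrix_apply, Matrix.mul_apply, mul_comm, Finsupp.finsetSum_apply]

theorem exists_matrix_det_ne_zero_of_mem_span {F M κ : Type*} [Field F] [AddCommGroup M]
    [Module F M] [Fintype κ] [DecidableEq κ] {v w : κ → M} (hv : LinearIndependent F v)
    (hvw : ∀ x, v x ∈ Submodule.span F (Set.range w)) :
    ∃ A : Matrix κ κ F, A.det ≠ 0 ∧ ∀ x, v x = ∑ y, A y x • w y := by
  choose u hu using fun x => (Submodule.mem_span_range_iff_exists_fun F).1 (hvw x)
  refine ⟨Matrix.of fun y x => u x y, fun hdet => ?_, fun x => (hu x).symm⟩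
  obtain ⟨t, ht, ht₀⟩ := Matrix.exists_mulVec_eq_zero_iff.2 hdet
  have relation : ∑ x, t x • v x = 0 := by
    calc ∑ x, t x • v x
        = ∑ y, (∑ x, u x y * t x) • w y := by
          simp only [← hu, Finset.smul_sum, smul_smul, Finset.sum_smul, mul_comm]
          exact Finset.sum_comm
      _ = 0 := Finset.sum_eq_zero fun y _ => by
          rw [show ∑ x, u x y * t x = 0 from congrFun ht₀ y, zero_smul]
  exact ht (funext (Fintype.linearIndependent_iff.1 hv t relation))

theorem prod_range_mul_zpow_neg_one_pow {F : Type*} [CommGroupWithZero F] (a : ℕ → F)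
    (ha : ∀ i, a i ≠ 0) (n : ℕ) :
    ∏ i ∈ Finset.range (n + 1), (a (i + 1) * a i) ^ ((-1 : ℤ) ^ (i + 1)) =
      a (n + 1) ^ ((-1 : ℤ) ^ (n + 1)) * (a 0)⁻¹ := by
  induction n with
  | zero => simp [mul_zpow]
  | succ n ih =>
    have : a (n + 1) ^ ((-1 : ℤ) ^ (n + 1)) ≠ 0 := zpow_ne_zero _ (ha (n + 1))
    rw [Finset.prod_range_succ, ih, mul_zpow, pow_succ (-1 : ℤ) (n + 1), mul_neg_one, zpow_neg,
      zpow_neg]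
    field_simp

variable {F : Type*} [Field F] {C : ℕ → Type*} [∀ i, AddCommGroup (C i)] [∀ i, Module F (C i)]
  {κ : ℕ → Type*}

/-- The family in degree `i` formed by the boundaries of the vectors `b (i + 1)` and by the
vectors `b i`; its determinants define the torsion. -/
abbrev boundaryFamily (d : ∀ i, C (i + 1) →ₗ[F] C i) (b : ∀ i, κ i → C i) (i : ℕ) :
    κ (i + 1) ⊕ κ i → C i :=
  Sum.elim (fun k => d i (b (i + 1) k)) (b i)

/-- The vectors `b i` are lifts of bases of the spaces of boundaries, as chosen in the definition
of the torsion. -/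
structure IsBoundaryLift (d : ∀ i, C (i + 1) →ₗ[F] C i) (b : ∀ i, κ i → C i) : Prop where
  isEmpty_zero : IsEmpty (κ 0)
  linearIndependent : ∀ i, LinearIndependent F fun k => d i (b (i + 1) k)
  span_eq : ∀ i, Submodule.span F (Set.range fun k => d i (b (i + 1) k)) = LinearMap.range (d i)

variable {d : ∀ i, C (i + 1) →ₗ[F] C i} {b b' : ∀ i, κ i → C i} [∀ i, Fintype (κ i)]

theorem IsBoundaryLift.card_eq {κ' : ℕ → Type*} [∀ i, Fintype (κ' i)] {b' : ∀ i, κ' i → C i}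
    (hb : IsBoundaryLift d b) (hb' : IsBoundaryLift d b') (i : ℕ) :
    Fintype.card (κ i) = Fintype.card (κ' i) := by
  cases i with
  | zero =>
    have := hb.isEmpty_zero
    have := hb'.isEmpty_zero
    rw [Fintype.card_eq_zero, Fintype.card_eq_zero]
  | succ i =>
    rw [← finrank_span_eq_card (hb.linearIndependent i), hb.span_eq, ← hb'.span_eq,
      finrank_span_eq_card (hb'.linearIndependent i)]

theorem IsBoundaryLift.exists_eq_sum_add_sum {A : ∀ i, Matrix (κ i) (κ i) F}
    (hd : IsAcyclic C d) (hb : IsBoundaryLift d b)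
    (hA : ∀ i x, d i (b' (i + 1) x) = ∑ y, A (i + 1) y x • d i (b (i + 1) y)) (i : ℕ) (x : κ i) :
    ∃ q : κ (i + 1) → F, b' i x = ∑ y, q y • d i (b (i + 1) y) + ∑ y, A i y x • b i y := by
  have mem_range : b' i x - ∑ y, A i y x • b i y ∈ LinearMap.range (d i) := by
    cases i with
    | zero => exact (hb.isEmpty_zero.false x).elim
    | succ i => simp [← hd.2 i, map_sub, map_sum, hA]
  rw [← hb.span_eq, Submodule.mem_span_range_iff_exists_fun] at mem_range
  obtain ⟨q, hq⟩ := mem_range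
  exact ⟨q, by rw [hq, sub_add_cancel]⟩

variable [∀ i, DecidableEq (κ i)]

theorem IsBoundaryLift.exists_transition (hb : IsBoundaryLift d b) (hb' : IsBoundaryLift d b') :
    ∃ A : ∀ i, Matrix (κ i) (κ i) F, (∀ i, (A i).det ≠ 0) ∧
      ∀ i x, d i (b' (i + 1) x) = ∑ y, A (i + 1) y x • d i (b (i + 1) y) := by
  choose A hA_det hA using fun i => exists_matrix_det_ne_zero_of_mem_span
    (w := fun k => d i (b (i + 1) k)) (hb'.linearIndependent i) fun x => by
      rw [hb.span_eq]
      exact ⟨_, rfl⟩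
  refine ⟨Nat.rec 1 fun i _ => A i, fun i => ?_, hA⟩
  cases i with
  | zero => exact Matrix.det_one.trans_ne one_ne_zero
  | succ i => exact hA_det i

-- The matrix of the change of basis is block triangular with diagonal blocks `A (i + 1)`, `A i`.
theorem IsBoundaryLift.sq_det_boundaryFamily {A : ∀ i, Matrix (κ i) (κ i) F}
    (hd : IsAcyclic C d) (hb : IsBoundaryLift d b)
    (hA : ∀ i x, d i (b' (i + 1) x) = ∑ y, A (i + 1) y x • d i (b (i + 1) y))
    {ι : Type*} [Fintype ι] [DecidableEq ι] (i : ℕ) (c : Basis ι F (C i))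
    (e e' : ι ≃ κ (i + 1) ⊕ κ i) :
    c.det (boundaryFamily d b' i ∘ e') ^ 2 =
      ((A (i + 1)).det ^ 2 * (A i).det ^ 2) * c.det (boundaryFamily d b i ∘ e) ^ 2 := by
  choose Q hQ using hb.exists_eq_sum_add_sum hd hA i
  have change : boundaryFamily d b' i = fun x => ∑ y,
      Matrix.fromBlocks (A (i + 1)) (Matrix.of fun y x => Q x y) 0 (A i) y x •
        boundaryFamily d b i y := by
    ext (x | x)
    · simpa using hA i x
    · simpa using hQ x
  rw [sq_det_comp_equiv_eq c _ e e', ← Basis.det_reindex, ← Basis.det_reindex, change,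
    det_sum_smul, Matrix.det_fromBlocks_zero₂₁]
  ring

variable {ι : ℕ → Type*} [∀ i, Fintype (ι i)] [∀ i, DecidableEq (ι i)]
  {c : ∀ i, Basis (ι i) F (C i)} {n : ℕ}

theorem IsTorsion.sq_eq {τ τ' : F} (hC : Subsingleton (C (n + 1))) (h : IsTorsion C d c n τ)
    (h' : IsTorsion C d c n τ') : τ' ^ 2 = τ ^ 2 := by
  obtain ⟨hd, r, b, e, hr, hb, rfl⟩ := h
  obtain ⟨-, r', b', e', hr', hb', rfl⟩ := h'
  have lift : IsBoundaryLift d b :=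
    ⟨by rw [hr]; infer_instance, fun i => (hb i).1, fun i => (hb i).2⟩
  have lift' : IsBoundaryLift d b' :=
    ⟨by rw [hr']; infer_instance, fun i => (hb' i).1, fun i => (hb' i).2⟩
  obtain rfl : r = r' := funext fun i => by simpa using lift.card_eq lift' i
  obtain ⟨A, hA_det, hA⟩ := lift.exists_transition lift'
  have sq_det (i : ℕ) := lift.sq_det_boundaryFamily hd hA i (c i) (e i) (e' i)
  have isEmpty_top : IsEmpty (Fin (r (n + 1))) :=
    ⟨fun k => (hb n).1.ne_zero k (by rw [Subsingleton.elim (b (n + 1) k) 0, map_zero])⟩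
  have isEmpty_zero := lift.isEmpty_zero
  have telescope : ∏ i ∈ Finset.range (n + 1),
      ((A (i + 1)).det ^ 2 * (A i).det ^ 2) ^ ((-1 : ℤ) ^ (i + 1)) = 1 := by
    rw [prod_range_mul_zpow_neg_one_pow (fun i => (A i).det ^ 2) fun i => pow_ne_zero 2 (hA_det i)]
    simp only [Matrix.det_isEmpty, one_pow, one_zpow, inv_one, mul_one]
  have sq_zpow (x : F) (k : ℤ) : (x ^ k) ^ 2 = (x ^ 2) ^ k := by
    rw [← zpow_natCast, ← zpow_natCast, zpow_comm]
  simp only [← Finset.prod_pow, sq_zpow]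
  calc ∏ i ∈ Finset.range (n + 1),
        ((c i).det (boundaryFamily d b' i ∘ e' i) ^ 2) ^ ((-1 : ℤ) ^ (i + 1))
      = ∏ i ∈ Finset.range (n + 1), (((A (i + 1)).det ^ 2 * (A i).det ^ 2) ^ ((-1 : ℤ) ^ (i + 1)) *
          ((c i).det (boundaryFamily d b i ∘ e i) ^ 2) ^ ((-1 : ℤ) ^ (i + 1))) :=
        Finset.prod_congr rfl fun i _ => by rw [sq_det, mul_zpow]
    _ = ∏ i ∈ Finset.range (n + 1),
          ((c i).det (boundaryFamily d b i ∘ e i) ^ 2) ^ ((-1 : ℤ) ^ (i + 1)) := by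
        rw [Finset.prod_mul_distrib, telescope, one_mul]

omit [∀ i, Fintype (κ i)] [∀ i, DecidableEq (κ i)]

theorem range_eq_span_of_span_boundaryFamily (hdd : ∀ i x, d i (d (i + 1) x) = 0) (i : ℕ)
    (hspan : Submodule.span F (Set.range (boundaryFamily d b (i + 1))) = ⊤) :
    LinearMap.range (d i) = Submodule.span F (Set.range fun k => d i (b (i + 1) k)) := by
  have boundaries_to_zero :
      d i '' Set.range (fun k => d (i + 1) (b (i + 1 + 1) k)) ⊆ {0} := by
    rintro _ ⟨_, ⟨k, rfl⟩, rfl⟩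
    exact hdd i _
  rw [LinearMap.range_eq_map, ← hspan, Submodule.map_span, Set.Sum.elim_range, Set.image_union,
    Submodule.span_union, Submodule.span_eq_bot.2 fun x hx => boundaries_to_zero hx, bot_sup_eq,
    ← Set.range_comp]
  rfl

theorem isAcyclic_of_boundaryFamily [∀ i, Finite (κ i)] [IsEmpty (κ 0)]
    (hdd : ∀ i x, d i (d (i + 1) x) = 0)
    (hli : ∀ i, LinearIndependent F (boundaryFamily d b i))
    (hspan : ∀ i, Submodule.span F (Set.range (boundaryFamily d b i)) = ⊤) : IsAcyclic C d := by
  have (i : ℕ) := Fintype.ofFinite (κ i)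
  have exists_sums (i : ℕ) (x : C i) : ∃ (u : κ (i + 1) → F) (v : κ i → F),
      x = ∑ k, u k • d i (b (i + 1) k) + ∑ k, v k • b i k := by
    obtain ⟨u, hu⟩ := (Submodule.mem_span_range_iff_exists_fun F).1
      ((hspan i).ge (Submodule.mem_top (x := x)))
    exact ⟨u ∘ Sum.inl, u ∘ Sum.inr, by simp [← hu, Fintype.sum_sum_type]⟩
  refine ⟨eq_top_iff.2 fun x _ => ?_, fun i => le_antisymm (fun x hx => ?_) ?_⟩
  · obtain ⟨u, v, rfl⟩ := exists_sums 0 x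
    exact ⟨∑ k, u k • b 1 k, by simp⟩
  · obtain ⟨u, v, rfl⟩ := exists_sums (i + 1) x
    have boundaries_li : LinearIndependent F fun k => d i (b (i + 1) k) :=
      (hli i).comp Sum.inl Sum.inl_injective
    have hv := Fintype.linearIndependent_iff.1 boundaries_li v (by simpa [hdd] using hx)
    exact ⟨∑ k, u k • b (i + 2) k, by simp [hv]⟩
  · rintro _ ⟨x, rfl⟩
    exact hdd i x

theorem isTorsion_of_det_ne_zero [IsEmpty (κ 0)] (hdd : ∀ i x, d i (d (i + 1) x) = 0)
    (b : ∀ i, κ i → C i) (e : ∀ i, ι i ≃ κ (i + 1) ⊕ κ i)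
    (hdet : ∀ i, (c i).det (boundaryFamily d b i ∘ e i) ≠ 0) (n : ℕ) :
    IsTorsion C d c n (∏ i ∈ Finset.range (n + 1),
      (c i).det (boundaryFamily d b i ∘ e i) ^ ((-1 : ℤ) ^ (i + 1))) := by
  have (i : ℕ) : Finite (κ i) := Finite.of_injective _ ((e i).symm.injective.comp Sum.inr_injective)
  have (i : ℕ) := Fintype.ofFinite (κ i)
  have isBasis (i : ℕ) := (Basis.is_basis_iff_det (c i)).2 (isUnit_iff_ne_zero.2 (hdet i))
  have hli (i : ℕ) : LinearIndependent F (boundaryFamily d b i) :=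
    (linearIndependent_equiv (e i)).1 (isBasis i).1
  have hspan (i : ℕ) : Submodule.span F (Set.range (boundaryFamily d b i)) = ⊤ := by
    rw [← (e i).surjective.range_comp, (isBasis i).2]
  let f (i : ℕ) : κ i ≃ Fin (Fintype.card (κ i)) := Fintype.equivFin (κ i)
  refine ⟨isAcyclic_of_boundaryFamily hdd hli hspan, fun i => Fintype.card (κ i),
    fun i => b i ∘ (f i).symm, fun i => (e i).trans ((f (i + 1)).sumCongr (f i)),
    Fintype.card_eq_zero, fun i => ⟨?_, ?_⟩, ?_⟩
  · exact ((hli i).comp Sum.inl Sum.inl_injective).comp _ (f (i + 1)).symm.injective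
  · rw [range_eq_span_of_span_boundaryFamily hdd i (hspan (i + 1)),
      ← (f (i + 1)).symm.surjective.range_comp fun k => d i (b (i + 1) k)]
    rfl
  · refine Finset.prod_congr rfl fun i _ => ?_
    congr 2
    funext x
    simp only [Function.comp_apply, Equiv.trans_apply]
    rcases e i x with k | k <;> simp

end TorsionChoices

section Blocks

open Module

section LinearAlgebra

variable {R V ι X Y Z : Type*} [CommRing R] [AddCommGroup V] [Module R V] [Fintype ι]
  [DecidableEq ι] [Fintype X] [DecidableEq X] [Fintype Y] [DecidableEq Y] [Finite Z]

/-- The bijection that orders the basis `Pi.basis fun _ : X => B` of `X → V`, where `B` is indexed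
by `ι`, according to a partition of `X` into two parts. -/
def sigmaEquivBlocks (ι : Type*) (φ : X ≃ Y ⊕ Z) : (Σ _ : X, ι) ≃ (ι × Y) ⊕ (ι × Z) :=
  ((Equiv.sigmaEquivProd X ι).trans (Equiv.prodComm X ι)).trans
    (((Equiv.refl ι).prodCongr φ).trans (Equiv.prodSumDistrib ι Y Z))

theorem det_sumElim_single_eq_prod_det (B : Basis ι R V) (φ : X ≃ Y ⊕ Z) (A : Y → V →ₗ[R] V)
    (u : ι × Y → X → V)
    (hu : ∀ k y y', u (k, y) (φ.symm (Sum.inl y')) = if y' = y then A y (B k) else 0) :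
    (Pi.basis fun _ : X => B).det
      (Sum.elim u (fun p : ι × Z => Pi.single (φ.symm (Sum.inr p.2)) (B p.1)) ∘
        sigmaEquivBlocks ι φ) = ∏ y, (A y).det := by
  classical
  cases nonempty_fintype Z
  rw [← Basis.det_reindex, Basis.det_apply]
  set M := ((Pi.basis fun _ : X => B).reindex (sigmaEquivBlocks ι φ)).toMatrix
    (Sum.elim u fun p : ι × Z => Pi.single (φ.symm (Sum.inr p.2)) (B p.1)) with hM
  have blocks : M = Matrix.fromBlocks
      (Matrix.blockDiagonal fun y => LinearMap.toMatrix B B (A y)) 0 M.toBlocks₂₁ 1 := by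
    refine (Matrix.fromBlocks_toBlocks M).symm.trans ?_
    congr 1
    · ext ⟨k, y⟩ ⟨k', y'⟩
      by_cases h : y = y' <;>
        simp [hM, sigmaEquivBlocks, Matrix.toBlocks₁₁, Basis.toMatrix_apply,
          Matrix.blockDiagonal_apply, LinearMap.toMatrix_apply, hu, h]
    · ext ⟨k, y⟩ ⟨k', y'⟩
      simp [hM, sigmaEquivBlocks, Matrix.toBlocks₁₂, Basis.toMatrix_apply]
    · ext ⟨k, y⟩ ⟨k', y'⟩
      by_cases h : y = y'
      · simp [hM, sigmaEquivBlocks, Matrix.toBlocks₂₂, Basis.toMatrix_apply, h, Matrix.one_apply,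
          Finsupp.single_apply, eq_comm]
      · simp [hM, sigmaEquivBlocks, Matrix.toBlocks₂₂, Basis.toMatrix_apply, h]
  rw [blocks, Matrix.det_fromBlocks_zero₁₂, Matrix.det_blockDiagonal, Matrix.det_one, mul_one]
  simp only [LinearMap.det_toMatrix]

end LinearAlgebra

variable {G : Type} [Group G] {V : Type} [AddCommGroup V] [Module ℂ V]

theorem CoverComplex.twistedBoundary_single (K : CoverComplex G) (ρ : Representation ℂ G V) (i : ℕ)
    (x : K.cell (i + 1)) (v : V) (y : K.cell i) :
    K.twistedBoundary ρ i (Pi.single x v) y = rightAction ρ (K.bdry i x y) v := by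
  simp only [CoverComplex.twistedBoundary, LinearMap.pi_apply, LinearMap.sum_apply,
    LinearMap.comp_apply, LinearMap.proj_apply]
  rw [Finset.sum_eq_single x (fun z _ hz => by simp [Pi.single_eq_of_ne hz]) (by simp),
    Pi.single_eq_same]

theorem CoverComplex.isTorsion_of_blocks (K : CoverComplex G) (ρ : Representation ℂ G V)
    (hdd : ∀ i x, K.twistedBoundary ρ i (K.twistedBoundary ρ (i + 1) x) = 0)
    {Y : ℕ → Type} [∀ i, Fintype (Y i)] [∀ i, DecidableEq (Y i)] [IsEmpty (Y 0)]
    (φ : ∀ i, K.cell i ≃ Y (i + 1) ⊕ Y i) (A : ∀ i, Y (i + 1) → (V →ₗ[ℂ] V))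
    (hA : ∀ i y, (A i y).det ≠ 0)
    (hblocks : ∀ i y y', rightAction ρ
      (K.bdry i ((φ (i + 1)).symm (Sum.inr y)) ((φ i).symm (Sum.inl y'))) =
        if y' = y then A i y else 0)
    {ι : Type*} [Fintype ι] [DecidableEq ι] (B : Basis ι ℂ V) (n : ℕ) :
    IsTorsion (K.TwistedChain V) (K.twistedBoundary ρ) (fun i => Pi.basis fun _ : K.cell i => B) n
      (∏ i ∈ Finset.range (n + 1), (∏ y, (A i y).det) ^ ((-1 : ℤ) ^ (i + 1))) := by
  let b (i : ℕ) (p : ι × Y i) : K.TwistedChain V i := Pi.single ((φ i).symm (Sum.inr p.2)) (B p.1)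
  have det_eq (i : ℕ) : (Pi.basis fun _ : K.cell i => B).det
      (boundaryFamily (K.twistedBoundary ρ) b i ∘ sigmaEquivBlocks ι (φ i)) = ∏ y, (A i y).det :=
    det_sumElim_single_eq_prod_det B (φ i) (A i)
      (fun p => K.twistedBoundary ρ i (b (i + 1) p)) fun k y y' => by
        rw [K.twistedBoundary_single, hblocks]
        split_ifs <;> rfl
  have torsion := isTorsion_of_det_ne_zero (c := fun i => Pi.basis fun _ : K.cell i => B) hdd b
    (fun i => sigmaEquivBlocks ι (φ i))
    (fun i => by rw [det_eq]; exact Finset.prod_ne_zero_iff.2 fun y _ => hA i y) n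
  simpa only [det_eq] using torsion

end Blocks

section FoxCalculus

open MonoidAlgebra

variable {G : Type} [Group G] {E : Type} (hol : E → G)

theorem pathHol_append (w w' : List (E × Bool)) :
    pathHol hol (w ++ w') = pathHol hol w * pathHol hol w' := by
  induction w with
  | nil => simp [pathHol]
  | cons x w ih => rcases x with ⟨e, _ | _⟩ <;> simp [pathHol, ih, mul_assoc]

theorem pathHol_edgePow {g m : ℕ} (hol : Cell1 g m → G) (e : Cell1 g m) (k : ℤ) :
    pathHol hol (edgePow e k) = hol e ^ k := by
  have replicate_true (n : ℕ) : pathHol hol (List.replicate n (e, true)) = hol e ^ n := by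
    induction n with
    | zero => simp [pathHol]
    | succ n ih => rw [List.replicate_succ, pathHol, ih, pow_succ']
  have replicate_false (n : ℕ) : pathHol hol (List.replicate n (e, false)) = (hol e)⁻¹ ^ n := by
    induction n with
    | zero => simp [pathHol]
    | succ n ih => rw [List.replicate_succ, pathHol, ih, pow_succ']
  rcases le_or_gt 0 k with h | h
  · rw [edgePow, decide_eq_true h, replicate_true, ← zpow_natCast, Int.natAbs_of_nonneg h]
  · rw [edgePow, decide_eq_false h.not_ge, replicate_false, inv_pow, ← zpow_natCast, ← zpow_neg,
      Int.ofNat_natAbs_of_nonpos h.le, neg_neg]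

theorem fst_eq_of_mem_edgePow {g m : ℕ} {e : Cell1 g m} {k : ℤ} {x : Cell1 g m × Bool}
    (h : x ∈ edgePow e k) : x.1 = e := by
  rw [List.eq_of_mem_replicate h]

theorem exists_gen_of_mem_boundaryEdgePath {g m : ℕ} {j : Fin (m + 1)} {x : Cell1 g m × Bool}
    (h : x ∈ boundaryEdgePath g m j) : ∃ y, x.1 = Cell1.gen y := by
  obtain ⟨y, -, rfl⟩ := List.mem_map.1 h
  exact ⟨y.1, rfl⟩

/-- `IsEdgePath src tgt p w q` says that `w` is an edge path from `p` to `q`, where `(e, true)`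
stands for the edge `e`, which runs from `src e` to `tgt e`, and `(e, false)` for its inverse. -/
def IsEdgePath {W : Type} (src tgt : E → W) : W → List (E × Bool) → W → Prop
  | p, [], q => p = q
  | p, (e, true) :: w, q => src e = p ∧ IsEdgePath src tgt (tgt e) w q
  | p, (e, false) :: w, q => tgt e = p ∧ IsEdgePath src tgt (src e) w q

section IsEdgePath

variable {W : Type} {src tgt : E → W}

theorem IsEdgePath.append {p q r : W} {w w' : List (E × Bool)} (h : IsEdgePath src tgt p w q)
    (h' : IsEdgePath src tgt q w' r) : IsEdgePath src tgt p (w ++ w') r := by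
  induction w generalizing p with
  | nil => cases h; exact h'
  | cons x w ih => rcases x with ⟨e, _ | _⟩ <;> exact ⟨h.1, ih h.2⟩

theorem isEdgePath_of_forall_loop {p : W} (w : List (E × Bool))
    (h : ∀ x ∈ w, src x.1 = p ∧ tgt x.1 = p) : IsEdgePath src tgt p w p := by
  induction w with
  | nil => rfl
  | cons x w ih =>
    have hx := h x List.mem_cons_self
    have hw := ih fun y hy => h y (List.mem_cons_of_mem x hy)
    rcases x with ⟨e, _ | _⟩
    · exact ⟨hx.2, by rwa [hx.1]⟩
    · exact ⟨hx.1, by rwa [hx.2]⟩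

theorem isEdgePath_attachingPath (S : SeifertIndex) (f : Cell2 S.g S.m) :
    IsEdgePath edgeSource edgeTarget Cell0.base (attachingPath S f) Cell0.base := by
  have core_path (j : Fin (S.m + 1)) (k : ℤ) : IsEdgePath edgeSource edgeTarget
      (Cell0.corePoint j) (edgePow (Cell1.core j : Cell1 S.g S.m) k) (Cell0.corePoint j) :=
    isEdgePath_of_forall_loop _ fun x hx => by
      rw [fst_eq_of_mem_edgePow hx]
      exact ⟨rfl, rfl⟩
  have boundary_path (j : Fin (S.m + 1)) : IsEdgePath edgeSource edgeTarget
      Cell0.base (boundaryEdgePath S.g S.m j) Cell0.base :=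
    isEdgePath_of_forall_loop _ fun x hx => by
      obtain ⟨y, hy⟩ := exists_gen_of_mem_boundaryEdgePath hx
      rw [hy]
      exact ⟨rfl, rfl⟩
  have arc_path (j : Fin (S.m + 1)) : IsEdgePath edgeSource edgeTarget
      Cell0.base [((Cell1.arc j : Cell1 S.g S.m), true)] (Cell0.corePoint j) := ⟨rfl, rfl⟩
  have arc_inv_path (j : Fin (S.m + 1)) : IsEdgePath edgeSource edgeTarget
      (Cell0.corePoint j) [((Cell1.arc j : Cell1 S.g S.m), false)] Cell0.base := ⟨rfl, rfl⟩
  match f with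
  | .inl x => exact ⟨rfl, rfl, rfl, rfl, rfl⟩
  | .inr (.inl j) =>
    exact (((boundary_path j).append (arc_path j)).append (core_path j _)).append (arc_inv_path j)
  | .inr (.inr j) => exact ⟨rfl, ((arc_path j).append (core_path j _)).append (arc_inv_path j)⟩

end IsEdgePath

variable [DecidableEq E]

theorem foxDeriv_append (w w' : List (E × Bool)) (c : E) :
    foxDeriv hol (w ++ w') c =
      foxDeriv hol w c + single (pathHol hol w) 1 * foxDeriv hol w' c := by
  induction w with
  | nil => simp [foxDeriv, pathHol, ← one_def]
  | cons x w ih =>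
    have single_mul (a b : G) : single (a * b) (1 : ℤ) = single a 1 * single b 1 := by
      rw [single_mul_single, one_mul]
    rcases x with ⟨e, _ | _⟩ <;> rw [List.cons_append, foxDeriv, ih, foxDeriv, pathHol, single_mul]
      <;> noncomm_ring

theorem foxDeriv_eq_zero {w : List (E × Bool)} {c : E} (h : ∀ x ∈ w, x.1 ≠ c) :
    foxDeriv hol w c = 0 := by
  induction w with
  | nil => rfl
  | cons x w ih =>
    have hx := h x List.mem_cons_self
    have hw := ih fun y hy => h y (List.mem_cons_of_mem x hy)
    rcases x with ⟨e, _ | _⟩ <;> simp [foxDeriv, hw, if_neg hx]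

/-- The fundamental formula of Fox calculus: the boundary of the lift of an edge path is the
difference of its end points. -/
theorem sum_foxDeriv_mul_of_isEdgePath [Fintype E] {W : Type} [DecidableEq W] {src tgt : E → W}
    {p q : W} {w : List (E × Bool)} (h : IsEdgePath src tgt p w q) (v : W) :
    ∑ e, foxDeriv hol w e *
        ((if tgt e = v then single (hol e) (1 : ℤ) else 0) - if src e = v then 1 else 0) =
      (if q = v then single (pathHol hol w) 1 else 0) - if p = v then 1 else 0 := by
  induction w generalizing p with
  | nil => cases h; simp [foxDeriv, pathHol, ← one_def]
  | cons x w ih =>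
    rcases x with ⟨e, _ | _⟩
    · obtain ⟨rfl, hw⟩ := h
      simp only [foxDeriv, mul_assoc, sub_mul _ (ite _ _ _), ← Finset.mul_sum,
        Finset.sum_sub_distrib, ih hw, ite_mul, one_mul, zero_mul, Finset.sum_ite_eq,
        Finset.mem_univ, if_true, pathHol]
      split_ifs <;> simp [mul_sub, single_mul_single, ← one_def]
      abel
    · obtain ⟨rfl, hw⟩ := h
      simp only [foxDeriv, mul_assoc, add_mul, ← Finset.mul_sum, Finset.sum_add_distrib, ih hw,
        ite_mul, one_mul, zero_mul, Finset.sum_ite_eq, Finset.mem_univ, if_true, pathHol]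
      split_ifs <;> simp [mul_sub, single_mul_single] <;> abel

theorem sum_foxDeriv_mul_single_sub_one [Fintype E] (w : List (E × Bool)) :
    ∑ e, foxDeriv hol w e * (single (hol e) 1 - 1) = single (pathHol hol w) 1 - 1 := by
  simpa using sum_foxDeriv_mul_of_isEdgePath hol
    (isEdgePath_of_forall_loop (src := fun _ => ()) (tgt := fun _ => ()) w fun _ _ => ⟨rfl, rfl⟩) ()

theorem foxDeriv_edgePow_mul {g m : ℕ} (hol : Cell1 g m → G) (c : Cell1 g m) (k : ℤ) :
    foxDeriv hol (edgePow c k) c * (single (hol c) 1 - 1) = single (hol c ^ k) 1 - 1 := by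
  rw [← pathHol_edgePow, ← sum_foxDeriv_mul_single_sub_one, Fintype.sum_eq_single c]
  intro e he
  have hw : ∀ x ∈ edgePow c k, x.1 ≠ e := fun x hx => (fst_eq_of_mem_edgePow hx).trans_ne he.symm
  rw [foxDeriv_eq_zero hol hw, zero_mul]

theorem commute_foxDeriv {w : List (E × Bool)} {c : E} (h : ∀ x ∈ w, x.1 = c) (k : ℤ) :
    Commute (single (hol c ^ k) (1 : ℤ)) (foxDeriv hol w c) := by
  induction w with
  | nil => exact Commute.zero_right _
  | cons x w ih =>
    have hw := ih fun y hy => h y (List.mem_cons_of_mem x hy)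
    have commute_single (l : ℤ) : Commute (single (hol c ^ k) (1 : ℤ)) (single (hol c ^ l) 1) := by
      rw [Commute, SemiconjBy, single_mul_single, single_mul_single, ← zpow_add, ← zpow_add,
        add_comm]
    obtain ⟨e, b⟩ := x
    obtain rfl : e = c := h _ List.mem_cons_self
    cases b
    · rw [foxDeriv, if_pos rfl, ← zpow_neg_one]
      exact (commute_single (-1)).mul_right (hw.sub_right (Commute.one_right _))
    · rw [foxDeriv, if_pos rfl]
      exact (Commute.one_right _).add_right ((zpow_one (hol e) ▸ commute_single 1).mul_right hw)

theorem single_zpow_sub_one_mul_foxDeriv_edgePow {g m : ℕ} (hol : Cell1 g m → G) (c : Cell1 g m)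
    (k l : ℤ) :
    (single (hol c ^ k) 1 - 1) * foxDeriv hol (edgePow c l) c =
      (single (hol c ^ l) 1 - 1) * foxDeriv hol (edgePow c k) c := by
  have commute_sub_one (a b : ℤ) : Commute (single (hol c ^ a) (1 : ℤ) - 1)
      (foxDeriv hol (edgePow c b) c) :=
    (commute_foxDeriv hol (fun _ hx => fst_eq_of_mem_edgePow hx) a).sub_left (Commute.one_left _)
  calc (single (hol c ^ k) 1 - 1) * foxDeriv hol (edgePow c l) c
    _ = foxDeriv hol (edgePow c k) c * ((single (hol c) 1 - 1) * foxDeriv hol (edgePow c l) c) := by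
      rw [← foxDeriv_edgePow_mul, mul_assoc]
    _ = foxDeriv hol (edgePow c k) c * (single (hol c ^ l) 1 - 1) := by
      have h := commute_sub_one 1 l
      rw [zpow_one] at h
      rw [h.eq, foxDeriv_edgePow_mul]
    _ = (single (hol c ^ l) 1 - 1) * foxDeriv hol (edgePow c k) c := (commute_sub_one l k).eq.symm

end FoxCalculus

section RightAction

open MonoidAlgebra

variable {G : Type} [Group G] {V : Type} [AddCommGroup V] [Module ℂ V]

/-- The right action of `ℤ[G]` given by `rightAction`, as a homomorphism to the opposite of the
endomorphism ring. -/
def rightActionHom (ρ : Representation ℂ G V) : MonoidAlgebra ℤ G →+* (Module.End ℂ V)ᵐᵒᵖ :=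
  (MonoidAlgebra.lift ℤ (Module.End ℂ V)ᵐᵒᵖ G
    { toFun := fun γ => MulOpposite.op (ρ γ⁻¹)
      map_one' := by simp
      map_mul' := fun a b => by simp }).toRingHom

theorem rightActionHom_apply (ρ : Representation ℂ G V) (a : MonoidAlgebra ℤ G) :
    rightActionHom ρ a = MulOpposite.op (rightAction ρ a) := by
  apply MulOpposite.unop_injective
  simp only [rightActionHom, rightAction, AlgHom.toRingHom_eq_coe, RingHom.coe_coe,
    MonoidAlgebra.lift_apply, MonoidHom.coe_mk, OneHom.coe_mk, Finsupp.sum]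
  rw [Finset.unop_sum]
  rfl

theorem rightActionHom_single (ρ : Representation ℂ G V) (γ : G) :
    rightActionHom ρ (single γ 1) = MulOpposite.op (ρ γ⁻¹) := by
  rw [rightActionHom_apply, rightAction]
  simp

theorem rightAction_eq_of_rightActionHom_eq {ρ : Representation ℂ G V} {a : MonoidAlgebra ℤ G}
    {f : Module.End ℂ V} (h : rightActionHom ρ a = MulOpposite.op f) : rightAction ρ a = f :=
  MulOpposite.op_injective ((rightActionHom_apply ρ a).symm.trans h)

theorem CoverComplex.twistedBoundary_twistedBoundary (K : CoverComplex G)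
    (ρ : Representation ℂ G V) (i : ℕ)
    (h : ∀ c c', rightActionHom ρ (∑ e, K.bdry (i + 1) c e * K.bdry i e c') = 0)
    (x : K.TwistedChain V (i + 2)) :
    K.twistedBoundary ρ i (K.twistedBoundary ρ (i + 1) x) = 0 := by
  suffices hc : K.twistedBoundary ρ i ∘ₗ K.twistedBoundary ρ (i + 1) = 0 from
    LinearMap.congr_fun hc x
  refine LinearMap.pi_ext fun c v => funext fun c' => ?_
  have h' := congrArg (fun f => f.unop v) (h c c')
  simp only [map_sum, map_mul, rightActionHom_apply, ← MulOpposite.op_mul, ← Finset.op_sum,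
    MulOpposite.unop_op, MulOpposite.unop_zero, LinearMap.zero_apply, LinearMap.sum_apply,
    Module.End.mul_apply] at h'
  rw [LinearMap.zero_apply, Pi.zero_apply, LinearMap.comp_apply, ← h', CoverComplex.twistedBoundary]
  simp only [LinearMap.pi_apply, LinearMap.sum_apply, LinearMap.comp_apply, LinearMap.proj_apply]
  exact Finset.sum_congr rfl fun e _ => congrArg _ (K.twistedBoundary_single ρ (i + 1) c v e)

end RightAction

section SeifertComplex

open MonoidAlgebra

variable {S : SeifertIndex} {G : Type} [Group G] {hol : Cell1 S.g S.m → G}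

theorem foxDeriv_boundaryEdgePath_eq_zero (j : Fin (S.m + 1)) {e : Cell1 S.g S.m}
    (he : ∀ y, Cell1.gen y ≠ e) : foxDeriv hol (boundaryEdgePath S.g S.m j) e = 0 := by
  refine foxDeriv_eq_zero hol fun x hx => ?_
  obtain ⟨y, hy⟩ := exists_gen_of_mem_boundaryEdgePath hx
  rw [hy]
  exact he y

theorem foxDeriv_edgePow_eq_zero {e e' : Cell1 S.g S.m} (k : ℤ) (he : e ≠ e') :
    foxDeriv hol (edgePow e k) e' = 0 :=
  foxDeriv_eq_zero hol fun x hx => by rwa [fst_eq_of_mem_edgePow hx]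

theorem sum_foxDeriv_boundaryEdgePath_mul (j : Fin (S.m + 1)) :
    ∑ x, foxDeriv hol (boundaryEdgePath S.g S.m j) (Cell1.gen x) *
      (single (hol (Cell1.gen x)) 1 - 1) =
      single (pathHol hol (boundaryEdgePath S.g S.m j)) 1 - 1 := by
  rw [← sum_foxDeriv_mul_single_sub_one]
  simp [Fintype.sum_sum_type, foxDeriv_boundaryEdgePath_eq_zero]

theorem boundary₂_torus_core (x : Gen S.g S.m) (k : Fin (S.m + 1)) :
    boundary₂ S hol (Cell2.torus x) (Cell1.core k) = 0 := by
  simp [boundary₂, attachingPath, foxDeriv]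

theorem boundary₂_torus_arc (x : Gen S.g S.m) (k : Fin (S.m + 1)) :
    boundary₂ S hol (Cell2.torus x) (Cell1.arc k) = 0 := by
  simp [boundary₂, attachingPath, foxDeriv]

theorem boundary₂_hSweep_gen (j : Fin (S.m + 1)) (y : Gen S.g S.m) :
    boundary₂ S hol (Cell2.hSweep j) (Cell1.gen y) = 0 := by
  simp [boundary₂, attachingPath, foxDeriv_append, foxDeriv_edgePow_eq_zero, foxDeriv]

theorem boundary₂_hSweep_fiber (j : Fin (S.m + 1)) :
    boundary₂ S hol (Cell2.hSweep j) Cell1.fiber = 1 := by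
  simp [boundary₂, attachingPath, foxDeriv_append, foxDeriv_edgePow_eq_zero, foxDeriv]

theorem boundary₂_qSweep_gen (j : Fin (S.m + 1)) (y : Gen S.g S.m) :
    boundary₂ S hol (Cell2.qSweep j) (Cell1.gen y) =
      foxDeriv hol (boundaryEdgePath S.g S.m j) (Cell1.gen y) := by
  simp [boundary₂, attachingPath, foxDeriv_append, foxDeriv_edgePow_eq_zero, foxDeriv]

theorem boundary₂_qSweep_fiber (j : Fin (S.m + 1)) :
    boundary₂ S hol (Cell2.qSweep j) Cell1.fiber = 0 := by
  simp [boundary₂, attachingPath, foxDeriv_append, foxDeriv_edgePow_eq_zero,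
    foxDeriv_boundaryEdgePath_eq_zero, foxDeriv]

section FillingHolonomy

variable (hfill : IsFillingHolonomy S hol)
include hfill

theorem boundary₂_hSweep_core (j k : Fin (S.m + 1)) :
    boundary₂ S hol (Cell2.hSweep j) (Cell1.core k) =
      if j = k then single (hol Cell1.fiber) 1 *
        foxDeriv hol (edgePow (Cell1.core j) (S.slopeα j)) (Cell1.core j) else 0 := by
  split_ifs with h
  · subst h
    simp [boundary₂, attachingPath, foxDeriv_append, foxDeriv, hfill.arc, ← one_def]
  · simp [boundary₂, attachingPath, foxDeriv_append, foxDeriv_edgePow_eq_zero, foxDeriv, h]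

theorem boundary₂_qSweep_core (j k : Fin (S.m + 1)) :
    boundary₂ S hol (Cell2.qSweep j) (Cell1.core k) =
      if j = k then single (hol (Cell1.core j) ^ S.slopeβ j) 1 *
        foxDeriv hol (edgePow (Cell1.core j) (-S.slopeβ j)) (Cell1.core j) else 0 := by
  split_ifs with h
  · subst h
    simp [boundary₂, attachingPath, foxDeriv_append, foxDeriv_boundaryEdgePath_eq_zero, foxDeriv,
      hfill.arc, hfill.pathHol_boundaryEdgePath, ← one_def]
  · simp [boundary₂, attachingPath, foxDeriv_append, foxDeriv_boundaryEdgePath_eq_zero,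
      foxDeriv_edgePow_eq_zero, foxDeriv, h]

theorem boundary₂_hSweep_arc (j k : Fin (S.m + 1)) :
    boundary₂ S hol (Cell2.hSweep j) (Cell1.arc k) =
      if j = k then single (hol Cell1.fiber) 1 - 1 else 0 := by
  split_ifs with h
  · simp [boundary₂, attachingPath, foxDeriv_append, foxDeriv_edgePow_eq_zero, foxDeriv,
      pathHol_edgePow, hfill.arc, hfill.fiber_mul_core_zpow, single_mul_single, mul_add, ← one_def,
      sub_eq_add_neg, h]
  · simp [boundary₂, attachingPath, foxDeriv_append, foxDeriv_edgePow_eq_zero, foxDeriv, h]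

theorem boundary₂_qSweep_arc (j k : Fin (S.m + 1)) :
    boundary₂ S hol (Cell2.qSweep j) (Cell1.arc k) =
      if j = k then single (hol (Cell1.core j) ^ S.slopeβ j) 1 - 1 else 0 := by
  split_ifs with h
  · simp [boundary₂, attachingPath, foxDeriv_append, foxDeriv_boundaryEdgePath_eq_zero,
      foxDeriv_edgePow_eq_zero, foxDeriv, pathHol_edgePow, hfill.arc,
      hfill.pathHol_boundaryEdgePath, single_mul_single, mul_add, ← one_def, sub_eq_add_neg, h]
  · simp [boundary₂, attachingPath, foxDeriv_append, foxDeriv_boundaryEdgePath_eq_zero,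
      foxDeriv_edgePow_eq_zero, foxDeriv, h]

end FillingHolonomy

theorem sum_boundary₃_mul (hfill : IsFillingHolonomy S hol) (j : Cell3 S.m)
    (F : Cell2 S.g S.m → MonoidAlgebra ℤ G) :
    ∑ f, boundary₃ S hol j f * F f =
      -∑ x, foxDeriv hol (boundaryEdgePath S.g S.m j) (Cell1.gen x) * F (Cell2.torus x) +
      ((1 - single (hol Cell1.fiber) 1) * F (Cell2.qSweep j) +
        (single (hol (Cell1.core j) ^ S.slopeβ j) 1 - 1) * F (Cell2.hSweep j)) := by
  rw [Fintype.sum_sum_type (α₁ := Gen S.g S.m) (α₂ := Fin (S.m + 1) ⊕ Fin (S.m + 1)),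
    Fintype.sum_sum_type (α₁ := Fin (S.m + 1)), ← Finset.sum_neg_distrib]
  congr 1
  · exact Finset.sum_congr rfl fun x _ =>
      neg_mul (foxDeriv hol (boundaryEdgePath S.g S.m j) (Cell1.gen x)) (F (Cell2.torus x))
  · simp [boundary₃, ite_mul, hfill.pathHol_boundaryEdgePath]

theorem sum_boundary₃_mul_boundary₂_core (hfill : IsFillingHolonomy S hol) (j : Cell3 S.m)
    (k : Fin (S.m + 1)) :
    ∑ f, boundary₃ S hol j f * boundary₂ S hol f (Cell1.core k) = 0 := by
  rw [sum_boundary₃_mul hfill, boundary₂_qSweep_core hfill, boundary₂_hSweep_core hfill]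
  simp only [boundary₂_torus_core, mul_zero, Finset.sum_const_zero, neg_zero, zero_add]
  split_ifs with h
  · let C (n : ℤ) : MonoidAlgebra ℤ G := single (hol (Cell1.core j) ^ n) 1
    let D (n : ℤ) := foxDeriv hol (edgePow (Cell1.core j) n) (Cell1.core j)
    have C_mul (k l : ℤ) : C k * C l = C (k + l) := by
      simp only [C, single_mul_single, ← zpow_add, mul_one]
    have exchange (k l : ℤ) : (C k - 1) * D l = (C l - 1) * D k :=
      single_zpow_sub_one_mul_foxDeriv_edgePow hol (Cell1.core j) k l
    have fiber_eq : hol Cell1.fiber = hol (Cell1.core j) ^ (-S.slopeα j) := by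
      rw [zpow_neg, ← mul_eq_one_iff_eq_inv, hfill.fiber_mul_core_zpow]
    rw [fiber_eq]
    change (1 - C (-S.slopeα j)) * (C (S.slopeβ j) * D (-S.slopeβ j)) +
      (C (S.slopeβ j) - 1) * (C (-S.slopeα j) * D (S.slopeα j)) = 0
    generalize S.slopeα j = a, S.slopeβ j = b
    calc (1 - C (-a)) * (C b * D (-b)) + (C b - 1) * (C (-a) * D a)
      _ = C (b - a) * ((C a - 1) * D (-b)) - C (b - a) * ((C (-b) - 1) * D a) := by
        simp only [← mul_assoc, mul_sub, sub_mul, C_mul, one_mul]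
        ring_nf
        abel
      _ = 0 := by rw [exchange, sub_self]
  · simp

section CentralFiber

variable {A : Type*} [Ring A] {φ : MonoidAlgebra ℤ G →+* A}
  (hφ : ∀ a, Commute (φ (single (hol Cell1.fiber) 1)) a)

theorem map_single_mul_map_single_inv (γ : G) : φ (single γ 1) * φ (single γ⁻¹ 1) = 1 := by
  rw [← map_mul, single_mul_single, mul_inv_cancel, one_mul, ← one_def, map_one]

include hφ

theorem map_conj_fiber (γ : G) :
    φ (single γ 1) * (φ (single (hol Cell1.fiber) 1) * φ (single γ⁻¹ 1)) =
      φ (single (hol Cell1.fiber) 1) := by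
  rw [(hφ _).eq, ← mul_assoc, map_single_mul_map_single_inv, one_mul]

theorem map_boundary₂_torus_gen (x y : Gen S.g S.m) :
    φ (boundary₂ S hol (Cell2.torus x) (Cell1.gen y)) =
      if x = y then φ (1 - single (hol Cell1.fiber) 1) else 0 := by
  have boundary_eq : boundary₂ S hol (Cell2.torus x) (Cell1.gen y) =
      if x = y then 1 - single (hol (Cell1.gen x)) 1 * (single (hol Cell1.fiber) 1 *
        single (hol (Cell1.gen x))⁻¹ 1) else 0 := by
    by_cases h : x = y <;> simp [boundary₂, attachingPath, foxDeriv, h, sub_eq_add_neg]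
  rw [boundary_eq, apply_ite φ, map_zero, map_sub, map_mul, map_mul, map_conj_fiber hφ, map_sub]

theorem map_boundary₂_torus_fiber (x : Gen S.g S.m) :
    φ (boundary₂ S hol (Cell2.torus x) Cell1.fiber) = φ (single (hol (Cell1.gen x)) 1 - 1) := by
  have boundary_eq : boundary₂ S hol (Cell2.torus x) Cell1.fiber =
      single (hol (Cell1.gen x)) 1 - single (hol (Cell1.gen x)) 1 * (single (hol Cell1.fiber) 1 *
        single (hol (Cell1.gen x))⁻¹ 1) * single (hol Cell1.fiber)⁻¹ 1 := by
    simp [boundary₂, attachingPath, foxDeriv, mul_add, mul_assoc, sub_eq_add_neg]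
  rw [boundary_eq, map_sub, map_mul, map_mul, map_mul, map_conj_fiber hφ,
    map_single_mul_map_single_inv, map_sub, map_one]

theorem map_sum_boundary₂_mul_boundary₁ (hfill : IsFillingHolonomy S hol) (f : Cell2 S.g S.m)
    (v : Cell0 S.m) : φ (∑ e, boundary₂ S hol f e * boundary₁ S hol e v) = 0 := by
  have map_pathHol : φ (single (pathHol hol (attachingPath S f)) 1) = 1 := by
    match f with
    | .inl x =>
      have pathHol_eq : single (pathHol hol (attachingPath S (Cell2.torus x))) (1 : ℤ) =
          single (hol (Cell1.gen x)) 1 * (single (hol Cell1.fiber) 1 *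
            single (hol (Cell1.gen x))⁻¹ 1) * single (hol Cell1.fiber)⁻¹ 1 := by
        simp [attachingPath, pathHol, single_mul_single, mul_assoc]
      rw [pathHol_eq, map_mul, map_mul, map_mul, map_conj_fiber hφ, map_single_mul_map_single_inv]
    | .inr (.inl j) =>
      simp [attachingPath, pathHol, pathHol_append, pathHol_edgePow, hfill.arc,
        hfill.pathHol_boundaryEdgePath, ← one_def]
    | .inr (.inr j) =>
      simp [attachingPath, pathHol, pathHol_append, pathHol_edgePow, hfill.arc,
        hfill.fiber_mul_core_zpow, ← one_def]
  refine (congrArg φ (sum_foxDeriv_mul_of_isEdgePath hol (isEdgePath_attachingPath S f) v)).trans ?_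
  split_ifs <;> simp [map_pathHol]

theorem map_sum_boundary₃_mul_boundary₂ (hfill : IsFillingHolonomy S hol) (j : Cell3 S.m)
    (e : Cell1 S.g S.m) : φ (∑ f, boundary₃ S hol j f * boundary₂ S hol f e) = 0 := by
  have fiber_commute (a : A) : Commute (φ (1 - single (hol Cell1.fiber) 1)) a := by
    rw [map_sub, map_one]
    exact (Commute.one_left a).sub_left (hφ a)
  match e with
  | .inl (.inl y) =>
    rw [sum_boundary₃_mul hfill, boundary₂_hSweep_gen, boundary₂_qSweep_gen, mul_zero, add_zero,
      map_add, map_neg, map_sum]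
    simp only [map_mul, map_boundary₂_torus_gen hφ, mul_ite, mul_zero, Finset.sum_ite_eq',
      Finset.mem_univ, if_true, (fiber_commute _).eq, neg_add_cancel]
  | .inl (.inr _) =>
    have gen_sum := congrArg φ (sum_foxDeriv_boundaryEdgePath_mul (hol := hol) j)
    rw [map_sum, hfill.pathHol_boundaryEdgePath] at gen_sum
    rw [sum_boundary₃_mul hfill, boundary₂_hSweep_fiber, boundary₂_qSweep_fiber, mul_zero, zero_add,
      mul_one, map_add, map_neg, map_sum, ← gen_sum]
    simp only [map_mul, map_boundary₂_torus_fiber hφ, neg_add_cancel]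
  | .inr (.inl k) => rw [sum_boundary₃_mul_boundary₂_core hfill, map_zero]
  | .inr (.inr k) =>
    rw [sum_boundary₃_mul hfill, boundary₂_qSweep_arc hfill, boundary₂_hSweep_arc hfill]
    simp only [boundary₂_torus_arc, mul_zero, Finset.sum_const_zero, neg_zero, zero_add, map_add,
      map_mul]
    rw [(fiber_commute _).eq]
    split_ifs <;> simp [mul_sub]

end CentralFiber

theorem cellComplex_twistedBoundary_twistedBoundary (hfill : IsFillingHolonomy S hol) {V : Type}
    [AddCommGroup V] [Module ℂ V] {ρ : Representation ℂ G V}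
    (hfiber : ∀ a, Commute (rightActionHom ρ (single (hol Cell1.fiber) 1)) a) (i : ℕ)
    (x : (cellComplex S hol).TwistedChain V (i + 2)) :
    (cellComplex S hol).twistedBoundary ρ i ((cellComplex S hol).twistedBoundary ρ (i + 1) x) =
      0 := by
  refine (cellComplex S hol).twistedBoundary_twistedBoundary ρ i (fun c c' => ?_) x
  match i, c, c' with
  | 0, f, v => exact map_sum_boundary₂_mul_boundary₁ hfiber hfill f v
  | 1, j, e => exact map_sum_boundary₃_mul_boundary₂ hfiber hfill j e
  | _ + 2, c, _ => exact Empty.elim c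

end SeifertComplex

section SeifertTorsionValue

open MonoidAlgebra Module

/-- The cells which the boundary operator pairs with cells one degree lower: the fiber and the
cores, the 2-cells over the circles of the wedge and those swept out by the fiber, and all the
3-cells. -/
def UpperCell (g m : ℕ) : ℕ → Type
  | 0 => Empty
  | 1 => Unit ⊕ Fin (m + 1)
  | 2 => Gen g m ⊕ Fin (m + 1)
  | 3 => Fin (m + 1)
  | _ + 4 => Empty

instance (g m : ℕ) : ∀ i, Fintype (UpperCell g m i)
  | 0 => inferInstanceAs (Fintype Empty)
  | 1 => inferInstanceAs (Fintype (Unit ⊕ Fin (m + 1)))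
  | 2 => inferInstanceAs (Fintype (Gen g m ⊕ Fin (m + 1)))
  | 3 => inferInstanceAs (Fintype (Fin (m + 1)))
  | _ + 4 => inferInstanceAs (Fintype Empty)

instance (g m : ℕ) : ∀ i, DecidableEq (UpperCell g m i)
  | 0 => inferInstanceAs (DecidableEq Empty)
  | 1 => inferInstanceAs (DecidableEq (Unit ⊕ Fin (m + 1)))
  | 2 => inferInstanceAs (DecidableEq (Gen g m ⊕ Fin (m + 1)))
  | 3 => inferInstanceAs (DecidableEq (Fin (m + 1)))
  | _ + 4 => inferInstanceAs (DecidableEq Empty)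

instance (g m : ℕ) : IsEmpty (UpperCell g m 0) := inferInstanceAs (IsEmpty Empty)

variable {S : SeifertIndex} {G : Type} [Group G] {hol : Cell1 S.g S.m → G}

/-- The pairing of the cells: each cell is an upper cell or lies under an upper cell one degree
higher (`base` under the fiber, the points under the cores, the generators under the tori, the arcs
under the 2-cells swept out by the fiber, and the 2-cells swept out by `q` under the 3-cells). -/
def cellMatching (S : SeifertIndex) (hol : Cell1 S.g S.m → G) :
    ∀ i, (cellComplex S hol).cell i ≃ UpperCell S.g S.m (i + 1) ⊕ UpperCell S.g S.m i
  | 0 => (Equiv.sumEmpty (Unit ⊕ Fin (S.m + 1)) Empty).symm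
  | 1 =>
    { toFun := fun e => match e with
        | .inl (.inl x) => .inl (.inl x)
        | .inl (.inr u) => .inr (.inl u)
        | .inr (.inl j) => .inr (.inr j)
        | .inr (.inr j) => .inl (.inr j)
      invFun := fun y => match y with
        | .inl (.inl x) => .inl (.inl x)
        | .inr (.inl u) => .inl (.inr u)
        | .inr (.inr j) => .inr (.inl j)
        | .inl (.inr j) => .inr (.inr j)
      left_inv := by rintro ((x | x) | (x | x)) <;> rfl
      right_inv := by rintro ((x | x) | (x | x)) <;> rfl }
  | 2 =>
    { toFun := fun e => match e with
        | .inl x => .inr (.inl x)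
        | .inr (.inl j) => .inl j
        | .inr (.inr j) => .inr (.inr j)
      invFun := fun y => match y with
        | .inr (.inl x) => .inl x
        | .inl j => .inr (.inl j)
        | .inr (.inr j) => .inr (.inr j)
      left_inv := by rintro (x | (x | x)) <;> rfl
      right_inv := by rintro (x | (x | x)) <;> rfl }
  | 3 => (Equiv.emptySum Empty (Fin (S.m + 1))).symm
  | _ + 4 => (Equiv.emptySum Empty Empty).symm

variable {V : Type} [AddCommGroup V] [Module ℂ V]

/-- The block of the twisted boundary operator between an upper cell and the cell under it, if the
fiber acts by `-1`. -/
def matchingBlock (S : SeifertIndex) (hol : Cell1 S.g S.m → G) (ρ : Representation ℂ G V) :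
    ∀ i, UpperCell S.g S.m (i + 1) → (V →ₗ[ℂ] V)
  | 0 => fun y => match y with
    | .inl _ => algebraMap ℂ (End ℂ V) (-2)
    | .inr j => ρ (hol (Cell1.core j))⁻¹ - 1
  | 1 => fun y => match y with
    | .inl _ => algebraMap ℂ (End ℂ V) 2
    | .inr _ => algebraMap ℂ (End ℂ V) (-2)
  | 2 => fun _ => algebraMap ℂ (End ℂ V) 2
  | _ + 3 => fun y => Empty.elim y

section Matching

variable {ρ : Representation ℂ G V} (hfiber : ρ (hol Cell1.fiber) = -1)
include hfiber

theorem rightActionHom_fiber : rightActionHom ρ (single (hol Cell1.fiber) 1) = -1 := by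
  have map_inv : ρ (hol Cell1.fiber)⁻¹ = -1 := by
    have h : ρ (hol Cell1.fiber)⁻¹ * ρ (hol Cell1.fiber) = 1 := by
      rw [← map_mul, inv_mul_cancel, map_one]
    rwa [hfiber, mul_neg_one, neg_eq_iff_eq_neg] at h
  rw [rightActionHom_single, map_inv, MulOpposite.op_neg, MulOpposite.op_one]

theorem commute_rightActionHom_fiber (a : (End ℂ V)ᵐᵒᵖ) :
    Commute (rightActionHom ρ (single (hol Cell1.fiber) 1)) a := by
  rw [rightActionHom_fiber hfiber]
  exact (Commute.one_left a).neg_left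

theorem rightActionHom_fiber_sub_one :
    rightActionHom ρ (single (hol Cell1.fiber) 1 - 1) =
      MulOpposite.op (algebraMap ℂ (End ℂ V) (-2)) := by
  rw [map_sub, map_one, rightActionHom_fiber hfiber, map_neg, map_ofNat]
  norm_num

theorem rightActionHom_one_sub_fiber :
    rightActionHom ρ (1 - single (hol Cell1.fiber) 1) =
      MulOpposite.op (algebraMap ℂ (End ℂ V) 2) := by
  rw [map_sub, map_one, rightActionHom_fiber hfiber, map_ofNat]
  norm_num

theorem rightAction_bdry_cellMatching (hfill : IsFillingHolonomy S hol) (i : ℕ)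
    (y : UpperCell S.g S.m (i + 1)) :
    rightAction ρ ((cellComplex S hol).bdry i ((cellMatching S hol (i + 1)).symm (Sum.inr y))
      ((cellMatching S hol i).symm (Sum.inl y))) = matchingBlock S hol ρ i y := by
  apply rightAction_eq_of_rightActionHom_eq
  match i, y with
  | 0, .inl () =>
    refine (congrArg (rightActionHom ρ) ?_).trans (rightActionHom_fiber_sub_one hfiber)
    change boundary₁ S hol Cell1.fiber Cell0.base = _
    simp [boundary₁, edgeSource, edgeTarget]
  | 0, .inr j =>
    change rightActionHom ρ (boundary₁ S hol (Cell1.core j) (Cell0.corePoint j)) =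
      MulOpposite.op (ρ (hol (Cell1.core j))⁻¹ - 1)
    simp [boundary₁, edgeSource, edgeTarget, rightActionHom_single]
  | 1, .inl x =>
    change rightActionHom ρ (boundary₂ S hol (Cell2.torus x) (Cell1.gen x)) = _
    rw [map_boundary₂_torus_gen (commute_rightActionHom_fiber hfiber), if_pos rfl]
    exact rightActionHom_one_sub_fiber hfiber
  | 1, .inr j =>
    change rightActionHom ρ (boundary₂ S hol (Cell2.hSweep j) (Cell1.arc j)) = _
    rw [boundary₂_hSweep_arc hfill, if_pos rfl]
    exact rightActionHom_fiber_sub_one hfiber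
  | 2, j =>
    refine (congrArg (rightActionHom ρ) ?_).trans (rightActionHom_one_sub_fiber hfiber)
    exact if_pos rfl
  | _ + 3, y => exact Empty.elim y

theorem rightAction_bdry_cellMatching_of_ne (hfill : IsFillingHolonomy S hol) (i : ℕ)
    (y y' : UpperCell S.g S.m (i + 1)) (h : y ≠ y') :
    rightAction ρ ((cellComplex S hol).bdry i ((cellMatching S hol (i + 1)).symm (Sum.inr y))
      ((cellMatching S hol i).symm (Sum.inl y'))) = 0 := by
  apply rightAction_eq_of_rightActionHom_eq
  rw [MulOpposite.op_zero]
  match i, y, y' with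
  | 0, .inl (), .inl () => exact absurd rfl h
  | 0, .inl (), .inr j =>
    change rightActionHom ρ (boundary₁ S hol Cell1.fiber (Cell0.corePoint j)) = 0
    simp [boundary₁, edgeSource, edgeTarget]
  | 0, .inr j, .inl () =>
    change rightActionHom ρ (boundary₁ S hol (Cell1.core j) Cell0.base) = 0
    simp [boundary₁, edgeSource, edgeTarget]
  | 0, .inr j, .inr k =>
    have hjk : j ≠ k := by rintro rfl; exact h rfl
    change rightActionHom ρ (boundary₁ S hol (Cell1.core j) (Cell0.corePoint k)) = 0
    simp [boundary₁, edgeSource, edgeTarget, hjk]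
  | 1, .inl x, .inl x' =>
    have hxx' : x ≠ x' := by rintro rfl; exact h rfl
    change rightActionHom ρ (boundary₂ S hol (Cell2.torus x) (Cell1.gen x')) = 0
    rw [map_boundary₂_torus_gen (commute_rightActionHom_fiber hfiber), if_neg hxx']
  | 1, .inl x, .inr k =>
    change rightActionHom ρ (boundary₂ S hol (Cell2.torus x) (Cell1.arc k)) = 0
    rw [boundary₂_torus_arc, map_zero]
  | 1, .inr j, .inl x =>
    change rightActionHom ρ (boundary₂ S hol (Cell2.hSweep j) (Cell1.gen x)) = 0
    rw [boundary₂_hSweep_gen, map_zero]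
  | 1, .inr j, .inr k =>
    have hjk : j ≠ k := by rintro rfl; exact h rfl
    change rightActionHom ρ (boundary₂ S hol (Cell2.hSweep j) (Cell1.arc k)) = 0
    rw [boundary₂_hSweep_arc hfill, if_neg hjk, map_zero]
  | 2, j, k => exact (congrArg (rightActionHom ρ) (if_neg h)).trans (map_zero _)
  | _ + 3, y, _ => exact Empty.elim y

end Matching

section Determinants

variable {ρ : Representation ℂ G V}

theorem det_algebraMap_end {K W : Type*} [Field K] [AddCommGroup W] [Module K W] (a : K) :
    LinearMap.det (algebraMap K (End K W) a) = a ^ finrank K W := by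
  rw [Module.algebraMap_end_eq_smul_id, LinearMap.det_smul, LinearMap.det_id, mul_one]

theorem det_matchingBlock_ne_zero
    (hdet : ∀ j, LinearMap.det (ρ (hol (Cell1.core j))⁻¹ - 1) ≠ 0) (i : ℕ)
    (y : UpperCell S.g S.m (i + 1)) : (matchingBlock S hol ρ i y).det ≠ 0 := by
  match i, y with
  | 0, .inl _ => exact (det_algebraMap_end _).trans_ne (by simp)
  | 0, .inr j => exact hdet j
  | 1, .inl _ => exact (det_algebraMap_end _).trans_ne (by simp)
  | 1, .inr _ => exact (det_algebraMap_end _).trans_ne (by simp)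
  | 2, _ => exact (det_algebraMap_end _).trans_ne (by simp)
  | _ + 3, y => exact Empty.elim y

theorem prod_det_matchingBlock_zero :
    ∏ y, (matchingBlock S hol ρ 0 y).det =
      (-2) ^ finrank ℂ V * ∏ j, LinearMap.det (ρ (hol (Cell1.core j))⁻¹ - 1) := by
  refine (Fintype.prod_sum_type (α₁ := Unit) (α₂ := Fin (S.m + 1)) _).trans ?_
  exact congrArg (· * _) ((Fintype.prod_unique _).trans (det_algebraMap_end _))

theorem prod_det_matchingBlock_one :
    ∏ y, (matchingBlock S hol ρ 1 y).det =
      (2 ^ finrank ℂ V) ^ (2 * S.g + S.m) * ((-2) ^ finrank ℂ V) ^ (S.m + 1) := by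
  refine (Fintype.prod_sum_type (α₁ := Gen S.g S.m) (α₂ := Fin (S.m + 1)) _).trans ?_
  congr 1
  · refine (Finset.prod_congr rfl fun j _ => det_algebraMap_end 2).trans ?_
    simp [two_mul]
  · exact (Finset.prod_congr rfl fun j _ => det_algebraMap_end (-2)).trans (Fin.prod_const _ _)

theorem prod_det_matchingBlock_two :
    ∏ y, (matchingBlock S hol ρ 2 y).det = (2 ^ finrank ℂ V) ^ (S.m + 1) :=
  (Finset.prod_congr (ι := Fin (S.m + 1)) rfl fun _ _ => det_algebraMap_end 2).trans
    (Fin.prod_const _ _)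

theorem prod_det_matchingBlock_three : ∏ y, (matchingBlock S hol ρ 3 y).det = 1 :=
  Finset.prod_of_isEmpty (ι := Empty) _

end Determinants

theorem exists_isTorsion_cellComplex {ρ : Representation ℂ G V} (hfill : IsFillingHolonomy S hol)
    (hfiber : ρ (hol Cell1.fiber) = -1)
    (hdet : ∀ j, LinearMap.det (ρ (hol (Cell1.core j))⁻¹ - 1) ≠ 0)
    {ι : Type*} [Fintype ι] [DecidableEq ι] (B : Basis ι ℂ V) :
    ∃ τ : ℂ, IsTorsion ((cellComplex S hol).TwistedChain V) ((cellComplex S hol).twistedBoundary ρ)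
      (fun i => Pi.basis fun _ : (cellComplex S hol).cell i => B) (cellComplex S hol).dim τ ∧
      ‖τ‖ = (2 ^ finrank ℂ V) ^ (2 * S.g + S.m) /
        (2 ^ finrank ℂ V * ∏ j, ‖LinearMap.det (ρ (hol (Cell1.core j))⁻¹ - 1)‖) := by
  refine ⟨_, (cellComplex S hol).isTorsion_of_blocks ρ
    (cellComplex_twistedBoundary_twistedBoundary hfill (commute_rightActionHom_fiber hfiber))
    (cellMatching S hol) (matchingBlock S hol ρ) (det_matchingBlock_ne_zero hdet)
    (fun i y y' => ?_) B _, ?_⟩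
  · split_ifs with h
    · rw [h, rightAction_bdry_cellMatching hfiber hfill]
    · exact rightAction_bdry_cellMatching_of_ne hfiber hfill i y y' (Ne.symm h)
  · change ‖∏ i ∈ Finset.range 4, _‖ = _
    have prod_ne_zero : ∏ j, ‖LinearMap.det (ρ (hol (Cell1.core j))⁻¹ - 1)‖ ≠ 0 :=
      Finset.prod_ne_zero_iff.2 fun j _ => norm_ne_zero_iff.2 (hdet j)
    rw [Finset.prod_range_succ, Finset.prod_range_succ, Finset.prod_range_succ,
      Finset.prod_range_one, prod_det_matchingBlock_zero, prod_det_matchingBlock_one,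
      prod_det_matchingBlock_two, prod_det_matchingBlock_three]
    simp
    field_simp

end SeifertTorsionValue

section Diagonalization

open Matrix Module

variable {K : Type*} [Field K]

theorem exists_basis_eigenvectors [IsAlgClosed K] {V : Type*} [AddCommGroup V] [Module K V]
    [FiniteDimensional K V] {f : End K V} (hf : f.IsSemisimple) :
    ∃ (b : Basis (Fin (finrank K V)) K V) (d : Fin (finrank K V) → K),
      ∀ i, f (b i) = d i • b i := by
  have hspan : ⊤ ≤ Submodule.span K (⋃ μ, (f.eigenspace μ : Set V)) := by
    rw [← hf.iSup_eigenspace_eq_top, Submodule.iSup_eq_span]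
  let b := (Basis.ofSpan hspan).reindex
    (Fintype.equivFinOfCardEq (finrank_eq_card_basis (Basis.ofSpan hspan)).symm)
  have hb (i) : ∃ μ, b i ∈ f.eigenspace μ := by
    have hmem : b i ∈ ⋃ μ, (f.eigenspace μ : Set V) := Basis.ofSpan_subset hspan <| by
      rw [Basis.reindex_apply]
      exact Set.mem_range_self _
    exact Set.mem_iUnion.1 hmem
  choose d hd using hb
  exact ⟨b, d, fun i => End.mem_eigenspace_iff.1 (hd i)⟩

theorem exists_isConj_diagonal_of_isSemisimple [IsAlgClosed K] {n : Type*} [Fintype n]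
    [DecidableEq n] {A : Matrix n n K} (hA : End.IsSemisimple (toLin' A)) :
    ∃ d : n → K, IsConj (diagonal d) A := by
  obtain ⟨b, d, hb⟩ := exists_basis_eigenvectors hA
  let e : Fin (finrank K (n → K)) ≃ n := (Fintype.equivFinOfCardEq (by simp)).symm
  let P := (Pi.basisFun K n).toMatrix (b.reindex e)
  have hP : IsUnit P := (isUnit_iff_isUnit_det _).2 ((Pi.basisFun K n).isUnit_det (b.reindex e))
  refine ⟨d ∘ e.symm, hP.unit, ?_⟩
  change P * _ = A * P
  ext i j
  have := congrFun (hb (e.symm j)) i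
  rw [mul_diagonal]
  simpa [P, mul_comm, mul_apply, mulVec, dotProduct, Basis.toMatrix_apply] using this.symm

theorem exists_isConj_diagonal_of_pow_eq_neg_one [IsAlgClosed K] [CharZero K] {n : Type*}
    [Fintype n] [DecidableEq n] {A : Matrix n n K} {a : ℕ} (ha : a ≠ 0) (h : A ^ a = -1) :
    ∃ d : n → K, IsConj (diagonal d) A := by
  refine exists_isConj_diagonal_of_isSemisimple <| End.isSemisimple_of_squarefree_aeval_eq_zero
    (Polynomial.separable_X_pow_sub_C (-1 : K) (Nat.cast_ne_zero.2 ha) (by simp)).squarefree ?_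
  simp [← toLin'_pow, h, ← End.one_eq_id]

theorem exists_isPrimitiveRoot_two_mul_of_pow_eq_neg_one [CharZero K] {z : K} {a : ℕ} (ha : a ≠ 0)
    (h : z ^ a = -1) : ∃ l, 0 < l ∧ l ∣ a ∧ IsPrimitiveRoot z (2 * l) := by
  have hdvd : orderOf z ∣ 2 * a := orderOf_dvd_of_pow_eq_one <| by
    rw [mul_comm, pow_mul, h, neg_one_sq]
  have heven : Even (orderOf z) := by
    by_contra hodd
    have hneg : (-1 : K) = 1 := by
      rw [← (Nat.not_even_iff_odd.1 hodd).neg_one_pow, ← h, ← pow_mul, mul_comm, pow_mul,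
        pow_orderOf_eq_one, one_pow]
    norm_num at hneg
  obtain ⟨l, hl⟩ := heven.two_dvd
  have hla : l ∣ a := Nat.dvd_of_mul_dvd_mul_left two_pos (hl ▸ hdvd)
  exact ⟨l, Nat.pos_of_dvd_of_pos hla (Nat.pos_of_ne_zero ha), hla, hl ▸ .orderOf z⟩

/-- `A` is conjugate to `diag(z, z⁻¹)` for a primitive `2l`-th root of unity `z`; this is the shape
of the images of the cores. -/
structure HasPrimitiveEigenvalue (A : SL(2, ℂ)) (l : ℕ) (z : ℂ) : Prop where
  pos : 0 < l
  isPrimitiveRoot : IsPrimitiveRoot z (2 * l)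
  isConj : IsConj (diagonal ![z, z⁻¹]) (A : Matrix (Fin 2) (Fin 2) ℂ)

theorem exists_hasPrimitiveEigenvalue {A : SL(2, ℂ)} {a : ℕ} (ha : a ≠ 0)
    (h : (A : Matrix (Fin 2) (Fin 2) ℂ) ^ a = -1) :
    ∃ l z, l ∣ a ∧ HasPrimitiveEigenvalue A l z := by
  obtain ⟨d, hd⟩ := exists_isConj_diagonal_of_pow_eq_neg_one ha h
  have hda : d 0 ^ a = -1 := by
    have hpow := h ▸ hd.pow a
    obtain ⟨P, hP⟩ := hpow
    rw [SemiconjBy, neg_one_mul, ← mul_neg_one, P.mul_right_inj, diagonal_pow] at hP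
    simpa using congrFun (congrFun hP 0) 0
  have hdet : d 0 * d 1 = 1 := by
    have := isConj_iff_eq.1 (detMonoidHom.map_isConj hd)
    simpa [A.2] using this
  have hd_eq : d = ![d 0, (d 0)⁻¹] := by
    ext i; fin_cases i
    · rfl
    · exact eq_inv_of_mul_eq_one_right hdet
  obtain ⟨l, hl, hla, hz⟩ := exists_isPrimitiveRoot_two_mul_of_pow_eq_neg_one ha hda
  exact ⟨l, d 0, hla, hl, hz, hd_eq ▸ hd⟩

theorem orderOf_eq_of_isConj {M : Type*} [Monoid M] {x y : M} (h : IsConj x y) :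
    orderOf x = orderOf y :=
  orderOf_eq_orderOf_iff.2 fun n =>
    ⟨fun hx => isConj_one_right.1 (hx ▸ h.pow n), fun hy => isConj_one_left.1 (hy ▸ h.pow n)⟩

theorem HasPrimitiveEigenvalue.orderOf_eq {A : SL(2, ℂ)} {l : ℕ} {z : ℂ}
    (h : HasPrimitiveEigenvalue A l z) : orderOf A = 2 * l := by
  have hz : orderOf (diagonal ![z, z⁻¹]) = orderOf z := orderOf_eq_orderOf_iff.2 fun k => by
    simp [diagonal_pow, ← diagonal_one, Fin.forall_fin_two]
  have hA : orderOf A = orderOf (A : Matrix (Fin 2) (Fin 2) ℂ) :=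
    (orderOf_injective SpecialLinearGroup.coeMonoidHom
      SpecialLinearGroup.coeMonoidHom_injective A).symm
  rw [h.isPrimitiveRoot.eq_orderOf, hA, ← orderOf_eq_of_isConj h.isConj, hz]

end Diagonalization

section BinaryForms

open Module MvPolynomial

/-- The exponent of the monomial `X 0 ^ i * X 1 ^ (k - i)`. -/
def formExponent (k : ℕ) (i : Fin (k + 1)) : Fin 2 →₀ ℕ :=
  Finsupp.single 0 (i : ℕ) + Finsupp.single 1 (k - i)

theorem formExponent_injective (k : ℕ) : Function.Injective (formExponent k) := fun i j h => by
  simpa [formExponent, Fin.ext_iff] using DFunLike.congr_fun h 0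

theorem range_formExponent (k : ℕ) : Set.range (formExponent k) = {d | d.degree = k} := by
  ext d
  rw [Set.mem_ofPred_eq, Finsupp.degree_eq_sum, Fin.sum_univ_two]
  constructor
  · rintro ⟨i, rfl⟩
    simp [formExponent, Nat.add_sub_cancel' i.is_le]
  · intro h
    refine ⟨⟨d 0, by omega⟩, Finsupp.ext fun x => ?_⟩
    fin_cases x <;> simp [formExponent]
    omega

theorem linearIndependent_formMonomial (k : ℕ) : LinearIndependent ℂ
    fun i => (monomial (formExponent k i) 1 : MvPolynomial (Fin 2) ℂ) := by
  have := (basisMonomials (Fin 2) ℂ).linearIndependent.comp _ (formExponent_injective k)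
  simpa only [Function.comp_def, coe_basisMonomials] using this

theorem span_formMonomial (k : ℕ) : Submodule.span ℂ
    (Set.range fun i => (monomial (formExponent k i) 1 : MvPolynomial (Fin 2) ℂ)) =
      homogeneousSubmodule (Fin 2) ℂ k := by
  rw [homogeneousSubmodule_eq_finsupp_supported, AddMonoidAlgebra.supported_eq_span_single,
    ← range_formExponent, ← Set.range_comp]
  rfl

/-- The basis of the binary forms of degree `k` that consists of the monomials. -/
def formBasis (k : ℕ) : Basis (Fin (k + 1)) ℂ (BinaryForms (k + 1)) :=
  (Basis.span (linearIndependent_formMonomial k)).map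
    (LinearEquiv.ofEq _ _ (span_formMonomial k))

theorem coe_formBasis (k : ℕ) (i : Fin (k + 1)) :
    (formBasis k i : MvPolynomial (Fin 2) ℂ) = monomial (formExponent k i) 1 := by
  rw [formBasis, Basis.map_apply, LinearEquiv.coe_ofEq_apply, Basis.span_apply]

theorem finrank_binaryForms {n : ℕ} (hn : n ≠ 0) : finrank ℂ (BinaryForms n) = n := by
  obtain ⟨k, rfl⟩ := Nat.exists_eq_succ_of_ne_zero hn
  rw [finrank_eq_card_basis (formBasis k), Fintype.card_fin]

theorem finiteDimensional_binaryForms {n : ℕ} (hn : n ≠ 0) :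
    FiniteDimensional ℂ (BinaryForms n) :=
  .of_finrank_pos (by rw [finrank_binaryForms hn]; exact Nat.pos_of_ne_zero hn)

/-- The substitution `p(z) ↦ p(A z)` on binary forms, for an arbitrary matrix `A`; on `SL(2, ℂ)` it
is the inverse of `symRep`. -/
def formSubstitute (n : ℕ) (A : Matrix (Fin 2) (Fin 2) ℂ) : End ℂ (BinaryForms n) :=
  (substitute A).toLinearMap.restrict (substitute_mem A (n - 1))

theorem formSubstitute_mul (n : ℕ) (A B : Matrix (Fin 2) (Fin 2) ℂ) :
    formSubstitute n (A * B) = formSubstitute n B * formSubstitute n A :=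
  LinearMap.ext fun p => Subtype.ext (substitute_mul A B p.1)

theorem formSubstitute_one (n : ℕ) : formSubstitute n 1 = 1 :=
  LinearMap.ext fun p => Subtype.ext (substitute_one p.1)

theorem symRep_inv (n : ℕ) (A : SL(2, ℂ)) : symRep n A⁻¹ = formSubstitute n A.1 :=
  LinearMap.ext fun p => Subtype.ext <|
    congrArg (fun B : SL(2, ℂ) => substitute B.1 p.1) (inv_inv A)

theorem formSubstitute_diagonal_formBasis (k : ℕ) (z w : ℂ) (i : Fin (k + 1)) :
    formSubstitute (k + 1) (Matrix.diagonal ![z, w]) (formBasis k i) =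
      (z ^ (i : ℕ) * w ^ (k - i : ℕ)) • formBasis k i := by
  apply Subtype.ext
  change substitute _ (formBasis k i).1 = (z ^ (i : ℕ) * w ^ (k - i : ℕ)) • (formBasis k i).1
  rw [coe_formBasis, monomial_eq, map_mul, substitute_C, Finsupp.prod_fintype _ _ (by simp),
    map_prod, Fin.prod_univ_two, Fin.prod_univ_two]
  simp only [map_pow, substitute_X, Fin.sum_univ_two]
  simp [formExponent, mul_pow, smul_eq_C_mul]
  ring

theorem symRep_two_mul_eq_neg_one {N : ℕ} (hN : N ≠ 0) {A : SL(2, ℂ)}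
    (hA : (A : Matrix (Fin 2) (Fin 2) ℂ) = -1) : symRep (2 * N) A = -1 := by
  have hinv : A⁻¹ = A := by
    refine inv_eq_of_mul_eq_one_right (Subtype.ext ?_)
    rw [Matrix.SpecialLinearGroup.coe_mul, hA, neg_one_mul, neg_neg,
      Matrix.SpecialLinearGroup.coe_one]
  have hdiag : (-1 : Matrix (Fin 2) (Fin 2) ℂ) = Matrix.diagonal ![-1, -1] := by
    ext i j
    fin_cases i <;> fin_cases j <;> simp
  obtain ⟨k, hk⟩ := Nat.exists_eq_succ_of_ne_zero (mul_ne_zero two_ne_zero hN)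
  have hodd : Odd k := ⟨N - 1, by omega⟩
  rw [← hinv, symRep_inv, hA, hdiag, hk]
  refine (formBasis k).ext fun i => ?_
  rw [formSubstitute_diagonal_formBasis, ← pow_add, Nat.add_sub_cancel' i.is_le,
    hodd.neg_one_pow]
  exact neg_one_smul ℂ (formBasis k i)

theorem det_eq_prod_of_apply_eq_smul {R M ι : Type*} [CommRing R] [AddCommGroup M] [Module R M]
    [Fintype ι] {f : End R M} (b : Basis ι R M) {d : ι → R} (h : ∀ i, f (b i) = d i • b i) :
    LinearMap.det f = ∏ i, d i := by
  classical
  have hmatrix : LinearMap.toMatrix b b f = Matrix.diagonal d := by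
    ext i j
    rw [LinearMap.toMatrix_apply, h, map_smul, Basis.repr_self, Matrix.diagonal_apply]
    by_cases hij : i = j <;> simp [hij]
  rw [← LinearMap.det_toMatrix b, hmatrix, Matrix.det_diagonal]

theorem det_formSubstitute_diagonal_sub_one (k : ℕ) (z w : ℂ) :
    LinearMap.det (formSubstitute (k + 1) (Matrix.diagonal ![z, w]) - 1) =
      ∏ i ∈ Finset.range (k + 1), (z ^ i * w ^ (k - i) - 1) := by
  rw [Finset.prod_range]
  refine det_eq_prod_of_apply_eq_smul (formBasis k) fun i => ?_
  rw [LinearMap.sub_apply, formSubstitute_diagonal_formBasis, End.one_apply, sub_smul, one_smul]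

theorem det_sub_one_eq_of_isConj {R M : Type*} [CommRing R] [AddCommGroup M] [Module R M]
    {f g : End R M} (h : IsConj f g) : LinearMap.det (f - 1) = LinearMap.det (g - 1) := by
  obtain ⟨u, hu⟩ := h
  exact isConj_iff_eq.1 <| LinearMap.det.map_isConj ⟨u, hu.sub_right (.one_right _)⟩

theorem isConj_formSubstitute (n : ℕ) {A B : Matrix (Fin 2) (Fin 2) ℂ} (h : IsConj A B) :
    IsConj (formSubstitute n A) (formSubstitute n B) := by
  obtain ⟨P, hP⟩ := h
  let u : (End ℂ (BinaryForms n))ˣ :=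
    { val := formSubstitute n P
      inv := formSubstitute n ↑P⁻¹
      val_inv := by rw [← formSubstitute_mul, P.inv_mul, formSubstitute_one]
      inv_val := by rw [← formSubstitute_mul, P.mul_inv, formSubstitute_one] }
  refine IsConj.symm ⟨u, ?_⟩
  change formSubstitute n P * formSubstitute n B = formSubstitute n A * formSubstitute n P
  rw [← formSubstitute_mul, ← formSubstitute_mul, hP.eq]

theorem norm_inv_sub_one {w : ℂ} (hw : ‖w‖ = 1) : ‖w⁻¹ - 1‖ = ‖w - 1‖ := by
  rw [Complex.inv_eq_conj hw, ← map_one (starRingEnd ℂ), ← map_sub, Complex.norm_conj, map_one]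

/-- An element with eigenvalues `z` and `z⁻¹` acts on the binary forms of degree `2 * N - 1` with
the eigenvalues `z ^ (2 * i + 1)` for `-N ≤ i < N`.  The product ranges over half of them; if
`‖z‖ = 1`, its square is the absolute value of the determinant of the action minus the identity. -/
def oddPowProd (z : ℂ) (N : ℕ) : ℝ := ∏ i ∈ Finset.range N, ‖z ^ (2 * i + 1) - 1‖

theorem prod_norm_pow_mul_inv_pow_sub_one {z : ℂ} (hz : ‖z‖ = 1) (N : ℕ) :
    ∏ i ∈ Finset.range (2 * N), ‖z ^ i * z⁻¹ ^ (2 * N - 1 - i) - 1‖ = oddPowProd z N ^ 2 := by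
  have hz0 : z ≠ 0 := norm_ne_zero_iff.1 (by simp [hz])
  have hexp (i : ℕ) (hi : i < 2 * N) :
      z ^ i * z⁻¹ ^ (2 * N - 1 - i) = z ^ (2 * i + 1 - 2 * N : ℤ) := by
    rw [inv_pow, ← zpow_natCast, ← zpow_natCast, ← zpow_neg, ← zpow_add₀ hz0]
    congr 1
    omega
  rw [two_mul, Finset.prod_range_add, ← Finset.prod_range_reflect, sq, oddPowProd, ← two_mul]
  congr 1 <;> refine Finset.prod_congr rfl fun i hi => ?_ <;> have hi := Finset.mem_range.1 hi
  · rw [hexp _ (by omega), show (2 * (N - 1 - i : ℕ) + 1 - 2 * N : ℤ) = -(2 * i + 1 : ℕ) by omega,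
      zpow_neg, zpow_natCast, norm_inv_sub_one (by rw [norm_pow, hz, one_pow])]
  · rw [hexp _ (by omega), show (2 * (N + i : ℕ) + 1 - 2 * N : ℤ) = (2 * i + 1 : ℕ) by omega,
      zpow_natCast]

theorem norm_det_formSubstitute_sub_one {A : Matrix (Fin 2) (Fin 2) ℂ} {z : ℂ}
    (hA : IsConj (Matrix.diagonal ![z, z⁻¹]) A) (hz : ‖z‖ = 1) {N : ℕ} (hN : N ≠ 0) :
    ‖LinearMap.det (formSubstitute (2 * N) A - 1)‖ = oddPowProd z N ^ 2 := by
  rw [← det_sub_one_eq_of_isConj (isConj_formSubstitute _ hA),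
    ← prod_norm_pow_mul_inv_pow_sub_one hz]
  obtain ⟨k, hk⟩ := Nat.exists_eq_succ_of_ne_zero (mul_ne_zero two_ne_zero hN)
  rw [hk, det_formSubstitute_diagonal_sub_one, norm_prod]
  rfl

end BinaryForms

section Asymptotics

open Filter

theorem periodic_sum_range_sub_mul {u : ℕ → ℝ} {l : ℕ} (hl : l ≠ 0) (hu : Function.Periodic u l) :
    Function.Periodic
      (fun N : ℕ => ∑ i ∈ Finset.range N, u i - N * ((∑ i ∈ Finset.range l, u i) / l)) l := by
  intro N
  have hl' : (l : ℝ) ≠ 0 := Nat.cast_ne_zero.2 hl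
  have hshift : ∑ i ∈ Finset.range N, u (l + i) = ∑ i ∈ Finset.range N, u i :=
    Finset.sum_congr rfl fun i _ => by rw [add_comm, hu]
  simp only [add_comm N l, Finset.sum_range_add, hshift, Nat.cast_add, add_mul,
    mul_div_cancel₀ _ hl']
  ring

theorem tendsto_sum_range_div_of_periodic {u : ℕ → ℝ} {l : ℕ} (hl : l ≠ 0)
    (hu : Function.Periodic u l) :
    Tendsto (fun N : ℕ => (∑ i ∈ Finset.range N, u i) / N) atTop
      (nhds ((∑ i ∈ Finset.range l, u i) / l)) := by
  set c := (∑ i ∈ Finset.range l, u i) / l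
  set v : ℕ → ℝ := fun N => ∑ i ∈ Finset.range N, u i - N * c
  have hv : Function.Periodic v l := periodic_sum_range_sub_mul hl hu
  have hbdd (N : ℕ) : |v N| ≤ ∑ i ∈ Finset.range l, |v i| := by
    rw [← hv.map_mod_nat N]
    exact Finset.single_le_sum (f := fun i => |v i|) (fun i _ => abs_nonneg _)
      (Finset.mem_range.2 (Nat.mod_lt N (Nat.pos_of_ne_zero hl)))
  have hlim : Tendsto (fun N : ℕ => v N / N) atTop (nhds 0) :=
    tendsto_bdd_div_atTop_nhds_zero (.of_forall fun N => (abs_le.1 (hbdd N)).1)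
      (.of_forall fun N => (abs_le.1 (hbdd N)).2) tendsto_natCast_atTop_atTop
  rw [← zero_add c]
  refine (hlim.add_const c).congr' ?_
  filter_upwards [eventually_ne_atTop 0] with N hN
  have hN' : (N : ℝ) ≠ 0 := Nat.cast_ne_zero.2 hN
  rw [sub_div, mul_div_cancel_left₀ _ hN', sub_add_cancel]

variable {z : ℂ} {l : ℕ}

theorem pow_odd_ne_one (hz : IsPrimitiveRoot z (2 * l)) (i : ℕ) : z ^ (2 * i + 1) ≠ 1 := fun h => by
  have := (Nat.dvd_mul_right 2 l).trans (hz.dvd_of_pow_eq_one _ h)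
  omega

theorem oddPowProd_ne_zero (hz : IsPrimitiveRoot z (2 * l)) (N : ℕ) : oddPowProd z N ≠ 0 :=
  Finset.prod_ne_zero_iff.2 fun i _ => norm_ne_zero_iff.2 (sub_ne_zero.2 (pow_odd_ne_one hz i))

/-- The odd powers of `z` are the roots of `X ^ l + 1`, which takes the value `2` at `1`. -/
theorem prod_one_sub_pow_odd {R : Type*} [CommRing R] [IsDomain R] {z : R} (hl : l ≠ 0)
    (hz : IsPrimitiveRoot z (2 * l)) :
    ∏ i ∈ Finset.range l, (1 - z ^ (2 * i + 1)) = 2 := by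
  have hpos : 0 < 2 * l := by omega
  have hzl : z ^ l = -1 := (hz.pow hpos (mul_comm 2 l)).eq_neg_one_of_two_right
  have h := congrArg (Polynomial.eval 1)
    (X_pow_sub_C_eq_prod (hz.pow hpos rfl) (Nat.pos_of_ne_zero hl) hzl)
  simpa [Polynomial.eval_prod, ← pow_mul, ← pow_succ, one_add_one_eq_two] using h.symm

theorem oddPowProd_self (hl : l ≠ 0) (hz : IsPrimitiveRoot z (2 * l)) : oddPowProd z l = 2 := by
  simp only [oddPowProd, norm_sub_rev (z ^ _) 1, ← norm_prod, prod_one_sub_pow_odd hl hz,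
    Complex.norm_ofNat]

theorem tendsto_log_oddPowProd_div (hl : l ≠ 0) (hz : IsPrimitiveRoot z (2 * l)) :
    Tendsto (fun N : ℕ => Real.log (oddPowProd z N) / N) atTop (nhds (Real.log 2 / l)) := by
  have hlog (N : ℕ) : Real.log (oddPowProd z N) =
      ∑ i ∈ Finset.range N, Real.log ‖z ^ (2 * i + 1) - 1‖ := Real.log_prod fun i _ =>
    norm_ne_zero_iff.2 (sub_ne_zero.2 (pow_odd_ne_one hz i))
  have hper : Function.Periodic (fun i : ℕ => Real.log ‖z ^ (2 * i + 1) - 1‖) l := fun i => by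
    simp only [show 2 * (i + l) + 1 = 2 * i + 1 + 2 * l by ring, pow_add, hz.pow_eq_one, mul_one]
  simpa only [← hlog, oddPowProd_self hl hz] using tendsto_sum_range_div_of_periodic hl hper

end Asymptotics

section TorsionAsymptotics

open Filter

/-- The absolute value of the torsion of `ρ_{2N}` when the cores of the solid tori act on `ℂ²` with
eigenvalues `z j` and `(z j)⁻¹`. -/
def torsionNorm (S : SeifertIndex) (z : Fin (S.m + 1) → ℂ) (N : ℕ) : ℝ :=
  (2 ^ (2 * N)) ^ (2 * S.g + S.m) / (2 ^ (2 * N) * ∏ j, oddPowProd (z j) N ^ 2)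

variable {S : SeifertIndex} {l : Fin (S.m + 1) → ℕ} {z : Fin (S.m + 1) → ℂ}

theorem log_torsionNorm_div (hz : ∀ j, IsPrimitiveRoot (z j) (2 * l j)) {N : ℕ} (hN : N ≠ 0) :
    Real.log (torsionNorm S z N) / (2 * N) =
      (2 * S.g + S.m - 1) * Real.log 2 - ∑ j, Real.log (oddPowProd (z j) N) / N := by
  have hN' : (N : ℝ) ≠ 0 := Nat.cast_ne_zero.2 hN
  have hsq (j : Fin (S.m + 1)) : oddPowProd (z j) N ^ 2 ≠ 0 :=
    pow_ne_zero 2 (oddPowProd_ne_zero (hz j) N)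
  have hprod : ∏ j, oddPowProd (z j) N ^ 2 ≠ 0 := Finset.prod_ne_zero_iff.2 fun j _ => hsq j
  rw [torsionNorm, Real.log_div (by positivity) (mul_ne_zero (by positivity) hprod),
    Real.log_mul (by positivity) hprod, Real.log_prod fun j _ => hsq j]
  simp only [Real.log_pow, ← Finset.mul_sum, ← Finset.sum_div]
  push_cast
  field_simp
  ring

theorem growthRate_log_torsionNorm_eq (hl₀ : l 0 = 1) (hl : ∀ j, l j ≠ 0) :
    (2 * S.g + S.m - 1) * Real.log 2 - ∑ j, Real.log 2 / l j =
      -(2 - 2 * (S.g : ℝ) - ∑ j : Fin S.m, ((l j.succ : ℝ) - 1) / (l j.succ : ℝ)) *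
        Real.log 2 := by
  have hdiv (j : Fin S.m) : ((l j.succ : ℝ) - 1) / l j.succ = 1 - (l j.succ : ℝ)⁻¹ := by
    rw [← one_sub_div (Nat.cast_ne_zero.2 (hl j.succ)), one_div]
  simp only [hdiv, Finset.sum_sub_distrib, Finset.sum_const, Finset.card_univ, Fintype.card_fin,
    nsmul_eq_mul, Fin.sum_univ_succ, hl₀, Nat.cast_one, div_eq_mul_inv, ← Finset.mul_sum]
  ring

theorem tendsto_log_torsionNorm_div (hl₀ : l 0 = 1) (hl : ∀ j, l j ≠ 0)
    (hz : ∀ j, IsPrimitiveRoot (z j) (2 * l j)) :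
    Tendsto (fun N : ℕ => Real.log (torsionNorm S z N) / (2 * N)) atTop
      (nhds (-(2 - 2 * (S.g : ℝ) - ∑ j : Fin S.m, ((l j.succ : ℝ) - 1) / (l j.succ : ℝ)) *
        Real.log 2)) := by
  rw [← growthRate_log_torsionNorm_eq hl₀ hl]
  refine (tendsto_const_nhds.sub
    (tendsto_finsetSum _ fun j _ => tendsto_log_oddPowProd_div (hl j) (hz j))).congr' ?_
  filter_upwards [eventually_ne_atTop 0] with N hN
  exact (log_torsionNorm_div hz hN).symm

theorem tendsto_div_sq_zero_of_tendsto_div {u : ℕ → ℝ} {c : ℝ}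
    (hu : Tendsto (fun N : ℕ => u N / (2 * N)) atTop (nhds c)) :
    Tendsto (fun N : ℕ => u N / (2 * N) ^ 2) atTop (nhds 0) := by
  have hinf : Tendsto (fun N : ℕ => 2 * (N : ℝ)) atTop atTop :=
    tendsto_natCast_atTop_atTop.const_mul_atTop two_pos
  exact (hu.div_atTop hinf).congr fun N => by rw [div_div, sq]

theorem orbifoldEulerChar_eq (S : SeifertIndex) :
    S.orbifoldEulerChar = 2 - 2 * (S.g : ℝ) - ∑ j, ((S.α j : ℝ) - 1) / (S.α j : ℝ) := by
  have hα (j : Fin S.m) : (S.α j : ℝ) ≠ 0 :=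
    Nat.cast_ne_zero.2 (two_pos.trans_le (S.two_le j)).ne'
  simp only [SeifertIndex.orbifoldEulerChar, one_sub_div (hα _)]

end TorsionAsymptotics

section SeifertRepresentation

open Module

variable {S : SeifertIndex} {T : S.Framing}
  {ρ : PiOne (Space S T) (Space.base S T) →* SL(2, ℂ)}
  (hρ : (ρ (Space.fiberClass S T) : Matrix (Fin 2) (Fin 2) ℂ) = -1)

section Cores

include hρ

theorem coreClass_pow_eq_neg_one (j : Fin (S.m + 1)) {a : ℕ} (ha : S.slopeα j = a) :
    (ρ (Space.coreClass S T j) : Matrix (Fin 2) (Fin 2) ℂ) ^ a = -1 := by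
  have h : ρ (Space.fiberClass S T) * ρ (Space.coreClass S T j) ^ a = 1 := by
    rw [← map_pow, ← map_mul, ← zpow_natCast, ← ha, Space.fiberClass_mul_coreClass_zpow, map_one]
  have h' := congrArg Subtype.val h
  rw [Matrix.SpecialLinearGroup.coe_mul, Matrix.SpecialLinearGroup.coe_pow, hρ, neg_one_mul] at h'
  exact neg_eq_iff_eq_neg.1 h'

theorem exists_hasPrimitiveEigenvalue_coreClass :
    ∃ (l : Fin (S.m + 1) → ℕ) (z : Fin (S.m + 1) → ℂ), l 0 = 1 ∧
      ∀ j, HasPrimitiveEigenvalue (ρ (Space.coreClass S T j)) (l j) (z j) := by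
  obtain ⟨l₀, z₀, hdvd, h₀⟩ := exists_hasPrimitiveEigenvalue one_ne_zero
    (coreClass_pow_eq_neg_one hρ 0 (a := 1) rfl)
  have h (j : Fin S.m) :
      ∃ l z, HasPrimitiveEigenvalue (ρ (Space.coreClass S T j.succ)) l z := by
    obtain ⟨l, z, -, h⟩ := exists_hasPrimitiveEigenvalue (two_pos.trans_le (S.two_le j)).ne'
      (coreClass_pow_eq_neg_one hρ j.succ rfl)
    exact ⟨l, z, h⟩
  choose l z h using h
  exact ⟨Fin.cons l₀ l, Fin.cons z₀ z, Nat.dvd_one.1 hdvd, Fin.cases h₀ h⟩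

end Cores

variable {l : Fin (S.m + 1) → ℕ} {z : Fin (S.m + 1) → ℂ}
  (hcore : ∀ j, HasPrimitiveEigenvalue (ρ (Space.coreClass S T j)) (l j) (z j))
  {N : ℕ} (hN : N ≠ 0)
include hcore hN

theorem norm_det_inducedRep_coreClass_sub_one (j : Fin (S.m + 1)) :
    ‖LinearMap.det (inducedRep ρ (2 * N) (Space.coreClass S T j)⁻¹ - 1)‖ =
      oddPowProd (z j) N ^ 2 := by
  have h : inducedRep ρ (2 * N) (Space.coreClass S T j)⁻¹ =
      formSubstitute (2 * N) (ρ (Space.coreClass S T j)).1 := by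
    rw [← symRep_inv, ← map_inv]
    rfl
  rw [h]
  exact norm_det_formSubstitute_sub_one (hcore j).isConj (Complex.norm_eq_one_of_pow_eq_one
    (hcore j).isPrimitiveRoot.pow_eq_one (mul_ne_zero two_ne_zero (hcore j).pos.ne')) hN

include hρ

theorem exists_isTorsion_coverComplex
    (B : Basis (Fin (finrank ℂ (BinaryForms (2 * N)))) ℂ (BinaryForms (2 * N))) :
    ∃ τ : ℂ, IsTorsion ((Space.coverComplex S T).TwistedChain (BinaryForms (2 * N)))
      ((Space.coverComplex S T).twistedBoundary (inducedRep ρ (2 * N)))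
      (fun i => Pi.basis fun _ : (Space.coverComplex S T).cell i => B)
      (Space.coverComplex S T).dim τ ∧ ‖τ‖ = torsionNorm S z N := by
  have hnorm (j : Fin (S.m + 1)) : ‖LinearMap.det (inducedRep ρ (2 * N)
      (Space.edgeClass S T (Cell1.core j))⁻¹ - 1)‖ = oddPowProd (z j) N ^ 2 :=
    norm_det_inducedRep_coreClass_sub_one hcore hN j
  have hdet (j : Fin (S.m + 1)) : LinearMap.det (inducedRep ρ (2 * N)
      (Space.edgeClass S T (Cell1.core j))⁻¹ - 1) ≠ 0 := by
    rw [← norm_ne_zero_iff, hnorm]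
    exact pow_ne_zero 2 (oddPowProd_ne_zero (hcore j).isPrimitiveRoot N)
  obtain ⟨τ, hτ, hτnorm⟩ := exists_isTorsion_cellComplex (Space.isFillingHolonomy_edgeClass S T)
    (symRep_two_mul_eq_neg_one hN hρ) hdet B
  simp only [hnorm, finrank_binaryForms (mul_ne_zero two_ne_zero hN)] at hτnorm
  exact ⟨τ, hτ, hτnorm⟩

theorem isAcyclicRep_and_exists_isReidemeisterTorsion :
    (Space.coverComplex S T).IsAcyclicRep (inducedRep ρ (2 * N)) ∧
      ∃ τ : ℂ, (Space.coverComplex S T).IsReidemeisterTorsion (inducedRep ρ (2 * N)) τ := by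
  have := finiteDimensional_binaryForms (mul_ne_zero two_ne_zero hN)
  obtain ⟨τ, hτ, -⟩ := exists_isTorsion_coverComplex hρ hcore hN (finBasis ℂ _)
  exact ⟨hτ.1, τ, _, hτ⟩

theorem norm_eq_torsionNorm {τ : ℂ}
    (hτ : (Space.coverComplex S T).IsReidemeisterTorsion (inducedRep ρ (2 * N)) τ) :
    ‖τ‖ = torsionNorm S z N := by
  obtain ⟨B, hB⟩ := hτ
  obtain ⟨τ', hτ', hnorm⟩ := exists_isTorsion_coverComplex hρ hcore hN B
  have hsub : Subsingleton ((Space.coverComplex S T).TwistedChain (BinaryForms (2 * N))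
      ((Space.coverComplex S T).dim + 1)) :=
    inferInstanceAs (Subsingleton (Empty → BinaryForms (2 * N)))
  have hsq : ‖τ‖ ^ 2 = ‖τ'‖ ^ 2 := by rw [← norm_pow, ← norm_pow, hB.sq_eq hsub hτ']
  rw [← hnorm]
  exact (pow_left_inj₀ (norm_nonneg _) (norm_nonneg _) two_ne_zero).1 hsq

end SeifertRepresentation

end

end SeifertTorsion

open SeifertTorsion

theorem theorem4p5 (S : SeifertTorsion.SeifertIndex) (T : S.Framing)
    (ρ : SeifertTorsion.PiOne (SeifertTorsion.Space S T) (SeifertTorsion.Space.base S T) →*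
      Matrix.SpecialLinearGroup (Fin 2) ℂ)
    (hρ : (ρ (SeifertTorsion.Space.fiberClass S T) : Matrix (Fin 2) (Fin 2) ℂ) = -1) :
    (∀ N : ℕ, 1 ≤ N →
      (SeifertTorsion.Space.coverComplex S T).IsAcyclicRep
        (SeifertTorsion.inducedRep ρ (2 * N)) ∧
      ∃ τ : ℂ, (SeifertTorsion.Space.coverComplex S T).IsReidemeisterTorsion
        (SeifertTorsion.inducedRep ρ (2 * N)) τ) ∧
    ∃ lam : Fin S.m → ℕ,
      (∀ j, 0 < lam j ∧
        orderOf (ρ (SeifertTorsion.Space.coreClass S T j.succ)) = 2 * lam j) ∧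
      ∀ Tor : ℕ → ℂ,
        (∀ N : ℕ, 1 ≤ N → (SeifertTorsion.Space.coverComplex S T).IsReidemeisterTorsion
          (SeifertTorsion.inducedRep ρ (2 * N)) (Tor N)) →
        Filter.Tendsto (fun N : ℕ => Real.log ‖Tor N‖ / (2 * (N : ℝ)) ^ 2)
          Filter.atTop (nhds 0) ∧
        Filter.Tendsto (fun N : ℕ => Real.log ‖Tor N‖ / (2 * (N : ℝ))) Filter.atTop
          (nhds (-(2 - 2 * (S.g : ℝ) - ∑ j, ((lam j : ℝ) - 1) / (lam j : ℝ)) * Real.log 2)) ∧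
        ((∀ j, lam j = S.α j) →
          Filter.Tendsto (fun N : ℕ => Real.log ‖Tor N‖ / (2 * (N : ℝ))) Filter.atTop
            (nhds (-(2 - 2 * (S.g : ℝ) - ∑ j, ((S.α j : ℝ) - 1) / (S.α j : ℝ)) * Real.log 2)) ∧
          -(2 - 2 * (S.g : ℝ) - ∑ j, ((S.α j : ℝ) - 1) / (S.α j : ℝ)) * Real.log 2 =
            -S.orbifoldEulerChar * Real.log 2) := by
  obtain ⟨l, z, hl₀, hcore⟩ := exists_hasPrimitiveEigenvalue_coreClass hρ
  refine ⟨fun N hN => isAcyclicRep_and_exists_isReidemeisterTorsion hρ hcore (by omega),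
    fun j => l j.succ, fun j => ⟨(hcore _).pos, (hcore _).orderOf_eq⟩, fun Tor hTor => ?_⟩
  have hlim : Filter.Tendsto (fun N : ℕ => Real.log ‖Tor N‖ / (2 * (N : ℝ))) Filter.atTop
      (nhds (-(2 - 2 * (S.g : ℝ) - ∑ j : Fin S.m, ((l j.succ : ℝ) - 1) / (l j.succ : ℝ)) *
        Real.log 2)) := by
    refine (tendsto_log_torsionNorm_div hl₀ (fun j => (hcore j).pos.ne')
      fun j => (hcore j).isPrimitiveRoot).congr' ?_
    filter_upwards [Filter.eventually_ge_atTop 1] with N hN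
    rw [norm_eq_torsionNorm hρ hcore (by omega) (hTor N hN)]
  refine ⟨tendsto_div_sq_zero_of_tendsto_div hlim, hlim, fun hα => ⟨?_, ?_⟩⟩
  · simpa only [hα] using hlim
  · rw [orbifoldEulerChar_eq]
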